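/- **Setting.** Let $K<n<p$ be integers ($n$ the sample size, $p$ the number of features, $K$ the number of latent factors), let $A\in\mathbb{R}^{p\times K}$ and $\beta\in\mathbb{R}^K$ be deterministic, and let $Z\in\mathbb{R}^K$, $E\in\mathbb{R}^p$, $\varepsilon\in\mathbb{R}$ be independent square-integrable random elements with mean zero, with $\Sigma_Z=\mathrm{Cov}(Z)$, $\Sigma_E=\mathrm{Cov}(E)$, $\sigma_\varepsilon^2=\mathrm{Var}(\varepsilon)$. Let $(Z_i,E_i,\varepsilon_i)$, $i=1,\dots,n$, be i.i.d. copies of $(Z,E,\varepsilon)$ and suppose that the data follow the factor regression model $$X_i=AZ_i+E_i,\qquad y_i=Z_i^\top\beta+\varepsilon_i,\qquad i=1,\dots,n.$$ Let $\mathbf{X}\in\mathbb{R}^{n\times p}$ be the matrix with rows $X_1,\dots,X_n$, let $\mathbf{y}=(y_1,\dots,y_n)^\top$, and let $$\widehat\alpha=\arg\min\Big\{\|\alpha\|:\ \|\mathbf{X}\alpha-\mathbf{y}\|=\min_{u\in\mathbb{R}^p}\|\mathbf{X}u-\mathbf{y}\|\Big\}$$ be the minimum-norm least squares estimator (Euclidean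 norms). Write $\sigma_n(\mathbf{X})$ for the $n$-th largest, i.e. smallest, singular value of $\mathbf{X}$; $\mathrm{r_e}(Q)=\mathrm{tr}(Q)/\|Q\|$ for the effective rank of a positive semi-definite matrix $Q\ne0$, where $\|Q\|$ is the operator norm, and $\mathrm{r_e}(0)=1$; and $\|U\|_{\psi_2}=\inf\{t>0:\ \mathbb{E}\exp(U^2/t^2)\le 2\}$ for the sub-Gaussian norm of a real random variable $U$. **Assumptions.** Let $M>0$. 1. $A$ and $\Sigma_Z$ both have rank $K$. 2. $E=\Sigma_E^{1/2}\tilde E$ almost surely, where the entries of $\tilde E\in\mathbb{R}^p$ are independent with mean zero, unit variance and sub-Gaussian norm at most $M$. 3. $Z=\Sigma_Z^{1/2}\tilde Z$ and $\varepsilon=\sigma_\varepsilon\tilde\varepsilon$ almost surely, where the entries of $\tilde Z\in\mathbb{R}^K$ and the random variable $\tilde\varepsilon\in\mathbb{R}$ have mean zero and sub-Gaussian norm at most $M$. **Proposition.** For every $M>0$ there are constants $C,c,c'>0$, depending only on $M$, such that in the above setting and under the above assumptions, if $\mathrm{r_e}(\Sigma_E)>C\,n$, then $\mathrm{tr}(\Sigma_E)>0$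 and, with probability at least $1-c/n$, $$\sigma_n^2(\mathbf{X})\ \ge\ c'\,\mathrm{tr}(\Sigma_E)\qquad\text{and}\qquad \mathbf{X}\widehat\alpha=\mathbf{y},$$ so that $\sigma_n^2(\mathbf{X})\ge c'\,\mathrm{tr}(\Sigma_E)>0$ and $\widehat\alpha$ interpolates the data. -/

import Mathlib

open MeasureTheory ProbabilityTheory
open scoped ENNReal NNReal

noncomputable section

namespace FactorRegression

/-! ### Matrices, singular values, minimum-norm least squares -/

/-- Euclidean norm of a vector. -/
def euclNorm {d : ℕ} (v : Fin d → ℝ) : ℝ := ‖(WithLp.toLp 2 v : EuclideanSpace ℝ (Fin d))‖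

/-- Operator norm of a square matrix with respect to the Euclidean norm. -/
def opNorm {p : ℕ} (Q : Matrix (Fin p) (Fin p) ℝ) : ℝ :=
  ‖Matrix.toEuclideanCLM (n := Fin p) (𝕜 := ℝ) Q‖

open Classical in
/-- Effective rank `tr Q / ‖Q‖`, with the convention that it is `1` if `Q = 0`. -/
def effRank {p : ℕ} (Q : Matrix (Fin p) (Fin p) ℝ) : ℝ :=
  if Q = 0 then 1 else Q.trace / opNorm Q

/-- The `k`-th largest singular value `σ_k(X)`, `k = 1, 2, …` (Mathlib counts from `0`). -/
def sigma {n p : ℕ} (k : ℕ) (X : Matrix (Fin n) (Fin p) ℝ) : ℝ :=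
  (Matrix.toEuclideanLin X).singularValues (k - 1)

/-- `α` minimizes `u ↦ ‖X u - y‖`. -/
def IsLeastSquares {n p : ℕ} (X : Matrix (Fin n) (Fin p) ℝ) (y : Fin n → ℝ)
    (α : Fin p → ℝ) : Prop :=
  ∀ u : Fin p → ℝ, euclNorm (X.mulVec α - y) ≤ euclNorm (X.mulVec u - y)

/-- `α` has minimal norm among all the minimizers of `u ↦ ‖X u - y‖`. -/
def IsMinNormLeastSquares {n p : ℕ} (X : Matrix (Fin n) (Fin p) ℝ) (y : Fin n → ℝ)
    (α : Fin p → ℝ) : Prop :=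
  IsLeastSquares X y α ∧ ∀ α' : Fin p → ℝ, IsLeastSquares X y α' → euclNorm α ≤ euclNorm α'

theorem exists_isLeastSquares {n p : ℕ} (X : Matrix (Fin n) (Fin p) ℝ) (y : Fin n → ℝ) :
    ∃ α, IsLeastSquares X y α := by
  let f := Matrix.toEuclideanLin X
  obtain ⟨v, hv, hmin⟩ := (LinearMap.range f).exists_norm_eq_iInf_of_complete_subspace
    (Submodule.complete_of_finiteDimensional _) (WithLp.toLp 2 y)
  obtain ⟨a, rfl⟩ := hv
  refine ⟨a.ofLp, fun u => ?_⟩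
  have h : ‖WithLp.toLp 2 y - f a‖ ≤ ‖WithLp.toLp 2 y - f (WithLp.toLp 2 u)‖ := by
    rw [hmin]
    exact ciInf_le (f := fun w : LinearMap.range f => ‖WithLp.toLp 2 y - (w : EuclideanSpace ℝ (Fin n))‖)
      ⟨0, by rintro _ ⟨w, rfl⟩; exact norm_nonneg _⟩ ⟨f (WithLp.toLp 2 u), ⟨_, rfl⟩⟩
  rw [norm_sub_rev, norm_sub_rev (WithLp.toLp 2 y)] at h
  exact h

theorem existsUnique_isMinNormLeastSquares {n p : ℕ} (X : Matrix (Fin n) (Fin p) ℝ)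
    (y : Fin n → ℝ) : ∃! α, IsMinNormLeastSquares X y α := by
  let f := Matrix.toEuclideanLin X
  let Y : EuclideanSpace ℝ (Fin n) := WithLp.toLp 2 y
  let S : Set (EuclideanSpace ℝ (Fin p)) := {a | ∀ u, ‖f a - Y‖ ≤ ‖f u - Y‖}
  have hS : ∀ a : EuclideanSpace ℝ (Fin p), a ∈ S ↔ IsLeastSquares X y a.ofLp := fun a =>
    ⟨fun h u => h (WithLp.toLp 2 u), fun h u => h u.ofLp⟩
  have hne : S.Nonempty := by
    obtain ⟨α, hα⟩ := exists_isLeastSquares X y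
    exact ⟨WithLp.toLp 2 α, (hS _).2 hα⟩
  have hconv : Convex ℝ S := by
    intro a ha b hb s t hs ht hst u
    have e : f (s • a + t • b) - Y = s • (f a - Y) + t • (f b - Y) := by
      have : Y = s • Y + t • Y := by rw [← add_smul, hst, one_smul]
      rw [map_add, map_smul, map_smul, smul_sub, smul_sub]
      nth_rewrite 1 [this]
      abel
    rw [e]
    calc _ ≤ s * ‖f a - Y‖ + t * ‖f b - Y‖ := by
          refine (norm_add_le _ _).trans ?_
          rw [norm_smul, norm_smul, Real.norm_of_nonneg hs, Real.norm_of_nonneg ht]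
      _ ≤ s * ‖f u - Y‖ + t * ‖f u - Y‖ := by
          gcongr
          · exact ha u
          · exact hb u
      _ = ‖f u - Y‖ := by rw [← add_mul, hst, one_mul]
  have hclosed : IsClosed S := by
    have : S = ⋂ u, {a | ‖f a - Y‖ ≤ ‖f u - Y‖} := by ext a; simp [S]
    rw [this]
    refine isClosed_iInter fun u => isClosed_le ?_ continuous_const
    exact ((LinearMap.continuous_of_finiteDimensional f).sub continuous_const).norm
  obtain ⟨a, haS, ha⟩ := exists_norm_eq_iInf_of_complete_convex hne hclosed.isComplete hconv 0
  have hmin : ∀ b ∈ S, ‖a‖ ≤ ‖b‖ := fun b hb => by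
    have h : ‖0 - a‖ ≤ ‖0 - b‖ := by
      rw [ha]
      exact ciInf_le (f := fun w : S => ‖(0 : EuclideanSpace ℝ (Fin p)) - w‖)
        ⟨0, by rintro _ ⟨w, rfl⟩; exact norm_nonneg _⟩ ⟨b, hb⟩
    simpa using h
  refine ⟨a.ofLp, ⟨(hS a).1 haS, fun α' h => hmin (WithLp.toLp 2 α') ((hS _).2 h)⟩, ?_⟩
  rintro β ⟨hβ, hβmin⟩
  let b : EuclideanSpace ℝ (Fin p) := WithLp.toLp 2 β
  have hbS : b ∈ S := (hS b).2 hβ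
  have hba : ‖b‖ ≤ ‖a‖ := hβmin a.ofLp ((hS a).1 haS)
  have hmid := hmin _ (hconv haS hbS (by norm_num : (0 : ℝ) ≤ 1 / 2)
    (by norm_num : (0 : ℝ) ≤ 1 / 2) (by norm_num))
  rw [← smul_add, norm_smul, Real.norm_of_nonneg (by norm_num)] at hmid
  have hpar := parallelogram_law_with_norm ℝ a b
  have h0 : ‖a - b‖ = 0 := by
    nlinarith [norm_nonneg a, norm_nonneg b, norm_nonneg (a - b), norm_nonneg (a + b)]
  have : a = b := sub_eq_zero.1 (norm_eq_zero.1 h0)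
  rw [this]

/-- The minimum-norm least squares estimator
`argmin {‖α‖ : ‖X α - y‖ = min_u ‖X u - y‖}`. -/
def minNormEstimator {n p : ℕ} (X : Matrix (Fin n) (Fin p) ℝ) (y : Fin n → ℝ) : Fin p → ℝ :=
  (existsUnique_isMinNormLeastSquares X y).choose

theorem minNormEstimator_spec {n p : ℕ} (X : Matrix (Fin n) (Fin p) ℝ) (y : Fin n → ℝ) :
    IsMinNormLeastSquares X y (minNormEstimator X y) :=
  (existsUnique_isMinNormLeastSquares X y).choose_spec.1

open scoped MatrixOrder in
/-- The positive semi-definite square root of a positive semi-definite matrix. -/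
def matSqrt {d : ℕ} (Q : Matrix (Fin d) (Fin d) ℝ) : Matrix (Fin d) (Fin d) ℝ := CFC.sqrt Q

/-! ### Random vectors -/

/-- The sub-Gaussian norm `inf {t > 0 : 𝔼 exp (U² / t²) ≤ 2}`, with value `∞` if there is
no such `t`. -/
def psi2Norm {Ω : Type*} [MeasurableSpace Ω] (μ : Measure Ω) (U : Ω → ℝ) : ℝ≥0∞ :=
  ⨅ (t : ℝ≥0) (_ : 0 < t)
    (_ : ∫⁻ ω, ENNReal.ofReal (Real.exp (U ω ^ 2 / (t : ℝ) ^ 2)) ∂μ ≤ 2), (t : ℝ≥0∞)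

/-- The covariance matrix of a random vector. -/
def covMat {Ω : Type*} [MeasurableSpace Ω] {d : ℕ} (μ : Measure Ω) (V : Ω → Fin d → ℝ) :
    Matrix (Fin d) (Fin d) ℝ :=
  Matrix.of fun i j => covariance (fun ω => V ω i) (fun ω => V ω j) μ

/-- The random variables of a factor regression model with sample size `n`, `p` features and
`K` factors: `Z`, `E`, `ε` are the population factor and noises, on `(Ω₀, P₀)`; `Zs i`, `Es i`,
`εs i` are those of the `i`-th observation, on `(Ω, P)`. -/
structure IsFactorModel {n p K : ℕ} {Ω₀ Ω : Type*} [MeasurableSpace Ω₀] [MeasurableSpace Ω]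
    (P₀ : Measure Ω₀) (P : Measure Ω)
    (Z : Ω₀ → Fin K → ℝ) (E : Ω₀ → Fin p → ℝ) (ε : Ω₀ → ℝ)
    (Zs : Fin n → Ω → Fin K → ℝ) (Es : Fin n → Ω → Fin p → ℝ) (εs : Fin n → Ω → ℝ) : Prop where
  memLp_Z : ∀ k, MemLp (fun ω => Z ω k) 2 P₀
  memLp_E : ∀ j, MemLp (fun ω => E ω j) 2 P₀
  memLp_ε : MemLp ε 2 P₀
  mean_Z : ∀ k, ∫ ω, Z ω k ∂P₀ = 0
  mean_E : ∀ j, ∫ ω, E ω j ∂P₀ = 0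
  mean_ε : ∫ ω, ε ω ∂P₀ = 0
  /-- `Z`, `E`, `ε` are independent: `E` of `ε`, and `Z` of the pair `(E, ε)`. -/
  indep_noise : IndepFun E ε P₀
  indep_Z : IndepFun Z (fun ω => (E ω, ε ω)) P₀
  /-- The observations are i.i.d. copies of `(Z, E, ε)`. -/
  copies : ∀ i, IdentDistrib (fun ω => (Zs i ω, Es i ω, εs i ω)) (fun ω => (Z ω, E ω, ε ω)) P P₀
  indep_sample : iIndepFun (fun i ω => (Zs i ω, Es i ω, εs i ω)) P

/-- The `n × p` data matrix with rows `X_i = A Z_i + E_i`. -/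
def dataMatrix {n p K : ℕ} {Ω : Type*} (A : Matrix (Fin p) (Fin K) ℝ)
    (Zs : Fin n → Ω → Fin K → ℝ) (Es : Fin n → Ω → Fin p → ℝ) (ω : Ω) :
    Matrix (Fin n) (Fin p) ℝ :=
  Matrix.of fun i => A.mulVec (Zs i ω) + Es i ω

/-- The response vector with entries `y_i = Z_iᵀ β + ε_i`. -/
def response {n K : ℕ} {Ω : Type*} (β : Fin K → ℝ)
    (Zs : Fin n → Ω → Fin K → ℝ) (εs : Fin n → Ω → ℝ) (ω : Ω) : Fin n → ℝ :=
  fun i => Zs i ω ⬝ᵥ β + εs i ω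

/-- `E = Σ_E^{1/2} Ẽ`, where `Ẽ` has independent entries with zero mean, unit variance and
sub-Gaussian norm at most `M`. -/
def NoiseSubGaussian {p : ℕ} {Ω₀ : Type*} [MeasurableSpace Ω₀] (P₀ : Measure Ω₀)
    (E : Ω₀ → Fin p → ℝ) (M : ℝ) : Prop :=
  ∃ Et : Ω₀ → Fin p → ℝ,
    (∀ᵐ ω ∂P₀, E ω = (matSqrt (covMat P₀ E)).mulVec (Et ω)) ∧
    (∀ j, AEMeasurable (fun ω => Et ω j) P₀) ∧
    iIndepFun (fun j ω => Et ω j) P₀ ∧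
    (∀ j, ∫ ω, Et ω j ∂P₀ = 0) ∧
    (∀ j, variance (fun ω => Et ω j) P₀ = 1) ∧
    (∀ j, psi2Norm P₀ (fun ω => Et ω j) ≤ ENNReal.ofReal M)

/-- `Z = Σ_Z^{1/2} Z̃`, where the entries of `Z̃` have zero mean and sub-Gaussian norm
at most `M`. -/
def FactorSubGaussian {K : ℕ} {Ω₀ : Type*} [MeasurableSpace Ω₀] (P₀ : Measure Ω₀)
    (Z : Ω₀ → Fin K → ℝ) (M : ℝ) : Prop :=
  ∃ Zt : Ω₀ → Fin K → ℝ,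
    (∀ᵐ ω ∂P₀, Z ω = (matSqrt (covMat P₀ Z)).mulVec (Zt ω)) ∧
    (∀ k, AEMeasurable (fun ω => Zt ω k) P₀) ∧
    (∀ k, ∫ ω, Zt ω k ∂P₀ = 0) ∧
    (∀ k, psi2Norm P₀ (fun ω => Zt ω k) ≤ ENNReal.ofReal M)

/-- `ε = σ_ε ε̃`, where `ε̃` has zero mean and sub-Gaussian norm at most `M`. -/
def ResponseNoiseSubGaussian {Ω₀ : Type*} [MeasurableSpace Ω₀] (P₀ : Measure Ω₀)
    (ε : Ω₀ → ℝ) (M : ℝ) : Prop :=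
  ∃ εt : Ω₀ → ℝ,
    (∀ᵐ ω ∂P₀, ε ω = Real.sqrt (variance ε P₀) * εt ω) ∧
    AEMeasurable εt P₀ ∧
    (∫ ω, εt ω ∂P₀ = 0) ∧
    psi2Norm P₀ εt ≤ ENNReal.ofReal M

end FactorRegression

end

/-!
The orthogonal projection `D` onto `(range A)ᗮ` annihilates the factor part of `Xᵀ u`, so `‖Xᵀ u‖`
is at least `‖D Eᵀ u‖`, where `E` has the noise vectors as rows. As `range A` has dimension at most
`K ≤ n` and `n ‖Σ_E‖` is small compared with `tr Σ_E`, the expectation `τ` of `‖D Eᵀ u‖²` for unit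
`u` is still at least `tr Σ_E / 2`.

For unit `u`, `‖D Eᵀ u‖²` has the form `‖∑ x_j y_j‖²` with independent sub-Gaussian `x_j`, and it is
within `τ / 2` of `τ` outside an event of probability `2 exp (-κ τ / ‖Σ_E‖)`, where `κ` depends only
on `M`. To see this, integrate `exp (θ ‖∑ x_j y_j‖²)` over one coordinate at a time. Up to additive
constants the exponent remains a quadratic form `θ ⟪w, W w⟫` in the sum `w` of the remaining terms,
and each integration replaces `W` by a Sherman–Morrison update: `W` is the inverse of
`1 - c ∑ y_j ⊗ y_j` over the coordinates already integrated out, with `c` proportional to `θ`. This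
avoids both decoupling and Gaussian comparison.

A union bound over a `1 / 8`-net of the unit sphere of `ℝⁿ`, which has at most `17ⁿ ≤ e³ⁿ` points,
against a tail of order `e⁻⁴ⁿ` gives `‖D Eᵀ u‖² ≥ τ / 4` for all unit `u`. Hence `Xᵀ` is injective
with smallest singular value at least `√(τ / 4)`, so `X` is onto and the estimator interpolates.
-/

namespace FactorRegression

theorem exp_le_add_exp_sq (x : ℝ) : Real.exp x ≤ x + Real.exp (x ^ 2) := by
  have hsq := Real.add_one_le_exp (x ^ 2)
  rcases le_total |x| 1 with h | h
  · linarith [(abs_le.1 (Real.abs_exp_sub_one_sub_id_le h)).2]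
  · rcases le_total 0 x with hx | hx
    · rw [abs_of_nonneg hx] at h
      have : Real.exp x ≤ Real.exp (x ^ 2) := Real.exp_le_exp.2 (by nlinarith)
      linarith
    · rw [abs_of_nonpos hx] at h
      nlinarith [Real.exp_le_one_iff.2 hx]

theorem exp_mul_le_convexComb {a : ℝ} (ha0 : 0 ≤ a) (ha1 : a ≤ 1) (y : ℝ) :
    Real.exp (a * y) ≤ 1 - a + a * Real.exp y := by
  simpa using convexOn_exp.2 (Set.mem_univ 0) (Set.mem_univ y) (sub_nonneg.2 ha1) ha0 (by ring)

theorem exp_le_quadratic_mul_exp_abs (u : ℝ) :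
    Real.exp u ≤ 1 + u + u ^ 2 * Real.exp |u| := by
  have h := Complex.norm_exp_sub_sum_le_norm_mul_exp (u : ℂ) 2
  simp only [Finset.sum_range_succ, Finset.sum_range_zero, pow_zero, pow_one, Nat.factorial_zero,
    Nat.factorial_one, Nat.cast_one, div_one, zero_add, Complex.norm_real, Real.norm_eq_abs,
    sq_abs] at h
  have h' : |Real.exp u - (1 + u)| ≤ u ^ 2 * Real.exp |u| := by
    rw [← Real.norm_eq_abs (_ - _), ← Complex.norm_real]
    exact_mod_cast h
  linarith [(abs_le.1 h').2]

theorem sq_mul_exp_half_le {w : ℝ} (hw : 0 ≤ w) : w ^ 2 * Real.exp (w / 2) ≤ 8 * Real.exp w := by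
  have h : w ^ 2 ≤ 8 * Real.exp (w / 2) := by
    nlinarith [Real.quadratic_le_exp_of_nonneg (x := w / 2) (by positivity)]
  calc w ^ 2 * Real.exp (w / 2) ≤ 8 * Real.exp (w / 2) * Real.exp (w / 2) := by gcongr
    _ = 8 * Real.exp w := by rw [mul_assoc, ← Real.exp_add, add_halves]

/-- A centred law on `ℝ` of unit variance with `𝔼 exp (x² / s²) ≤ 2`, that is, of sub-Gaussian norm
at most `s`. -/
structure IsStdSubGaussian (s : ℝ) (ν : Measure ℝ) : Prop where
  pos : 0 < s
  mean : ∫ x, x ∂ν = 0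
  second : ∫ x, x ^ 2 ∂ν = 1
  integrable_exp : Integrable (fun x => Real.exp (x ^ 2 / s ^ 2)) ν
  integral_exp_le : ∫ x, Real.exp (x ^ 2 / s ^ 2) ∂ν ≤ 2

namespace IsStdSubGaussian

variable {s : ℝ} {ν : Measure ℝ}

theorem integrable_sq (h : IsStdSubGaussian s ν) : Integrable (fun x : ℝ => x ^ 2) ν :=
  Integrable.of_integral_ne_zero (by rw [h.second]; exact one_ne_zero)

variable [IsProbabilityMeasure ν]

theorem integrable_id (h : IsStdSubGaussian s ν) : Integrable (fun x : ℝ => x) ν :=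
  ((memLp_two_iff_integrable_sq (by fun_prop)).2 h.integrable_sq).integrable one_le_two

theorem lintegral_exp_le_of_le (h : IsStdSubGaussian s ν) {f : ℝ → ℝ} {a b c d : ℝ} (hd : 0 ≤ d)
    (hf : ∀ x, Real.exp (f x) ≤ a + b * x + c * x ^ 2 + d * Real.exp (x ^ 2 / s ^ 2)) :
    ∫⁻ x, ENNReal.ofReal (Real.exp (f x)) ∂ν ≤ ENNReal.ofReal (a + c + 2 * d) := by
  have hb := h.integrable_id.const_mul b
  have hc := h.integrable_sq.const_mul c
  have hd' := h.integrable_exp.const_mul d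
  have hab : Integrable (fun x => a + b * x) ν := (integrable_const a).add hb
  have habc : Integrable (fun x => a + b * x + c * x ^ 2) ν := hab.add hc
  calc ∫⁻ x, ENNReal.ofReal (Real.exp (f x)) ∂ν
      ≤ ∫⁻ x, ENNReal.ofReal (a + b * x + c * x ^ 2 + d * Real.exp (x ^ 2 / s ^ 2)) ∂ν :=
        lintegral_mono fun x => ENNReal.ofReal_le_ofReal (hf x)
    _ = ENNReal.ofReal (∫ x, (a + b * x + c * x ^ 2 + d * Real.exp (x ^ 2 / s ^ 2)) ∂ν) :=
        (ofReal_integral_eq_lintegral_ofReal (habc.add hd')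
          (ae_of_all _ fun x => (Real.exp_pos _).le.trans (hf x))).symm
    _ ≤ ENNReal.ofReal (a + c + 2 * d) := by
        refine ENNReal.ofReal_le_ofReal ?_
        rw [integral_add habc hd', integral_add hab hc, integral_add (integrable_const a) hb,
          integral_const_mul b fun x => x]
        simp only [integral_const_mul, integral_const, probReal_univ, one_smul, h.mean, h.second]
        nlinarith [h.integral_exp_le]

theorem one_le_sq (h : IsStdSubGaussian s ν) : 1 ≤ s ^ 2 := by
  have hs := h.pos
  have key : 1 + 1 / s ^ 2 ≤ 2 := calc
    1 + 1 / s ^ 2 = ∫ x, (1 + x ^ 2 / s ^ 2) ∂ν := by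
      rw [integral_add (integrable_const _) (h.integrable_sq.div_const _), integral_div, h.second]
      simp
    _ ≤ ∫ x, Real.exp (x ^ 2 / s ^ 2) ∂ν :=
      integral_mono ((integrable_const _).add (h.integrable_sq.div_const _)) h.integrable_exp
        fun x => by simpa only [add_comm] using Real.add_one_le_exp (x ^ 2 / s ^ 2)
    _ ≤ 2 := h.integral_exp_le
  exact (div_le_one (by positivity)).1 (by linarith)

theorem lintegral_exp_mul_le (h : IsStdSubGaussian s ν) (t : ℝ) :
    ∫⁻ x, ENNReal.ofReal (Real.exp (t * x)) ∂ν ≤ ENNReal.ofReal (Real.exp (s ^ 2 * t ^ 2)) := by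
  have hs := h.pos
  obtain ⟨a, ha⟩ : ∃ a, a = s ^ 2 * t ^ 2 := ⟨_, rfl⟩
  have ha0 : 0 ≤ a := by rw [ha]; positivity
  rw [← ha]
  rcases le_total a 1 with ha1 | ha1
  · refine (h.lintegral_exp_le_of_le (a := 1 - a) (b := t) (c := 0) ha0 fun x => ?_).trans
      (ENNReal.ofReal_le_ofReal (by linarith [Real.add_one_le_exp a]))
    have hconv := exp_mul_le_convexComb ha0 ha1 (x ^ 2 / s ^ 2)
    have hax : a * (x ^ 2 / s ^ 2) = (t * x) ^ 2 := by rw [ha]; field_simp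
    rw [hax] at hconv
    linarith [exp_le_add_exp_sq (t * x)]
  · refine (h.lintegral_exp_le_of_le (a := Real.exp (a / 2) / 2) (b := 0) (c := 0)
      (d := Real.exp (a / 2) / 2) (by positivity) fun x => ?_).trans
      (ENNReal.ofReal_le_ofReal ?_)
    · have hamgm : t * x ≤ a / 2 + 1 / 2 * (x ^ 2 / s ^ 2) := by
        have e : (s * t - x / s) ^ 2 = a - 2 * (t * x) + x ^ 2 / s ^ 2 := by
          rw [ha]; field_simp; ring
        linarith [sq_nonneg (s * t - x / s)]
      have hconv := exp_mul_le_convexComb (a := 1 / 2) (by norm_num) (by norm_num) (x ^ 2 / s ^ 2)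
      calc Real.exp (t * x) ≤ Real.exp (a / 2) * Real.exp (1 / 2 * (x ^ 2 / s ^ 2)) := by
            rw [← Real.exp_add]; exact Real.exp_le_exp.2 hamgm
        _ ≤ Real.exp (a / 2) * (1 - 1 / 2 + 1 / 2 * Real.exp (x ^ 2 / s ^ 2)) := by gcongr
        _ = _ := by ring
    · have hsplit : Real.exp a = Real.exp (a / 2) * Real.exp (a / 2) := by
        rw [← Real.exp_add, add_halves]
      nlinarith [Real.add_one_le_exp (a / 2)]

theorem lintegral_exp_mul_sq_le (h : IsStdSubGaussian s ν) {η : ℝ} (hη : |η| * s ^ 2 ≤ 1 / 2) :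
    ∫⁻ x, ENNReal.ofReal (Real.exp (η * x ^ 2)) ∂ν
      ≤ ENNReal.ofReal (Real.exp (η + 16 * s ^ 4 * η ^ 2)) := by
  have hs := h.pos
  refine (h.lintegral_exp_le_of_le (a := 1) (b := 0) (c := η) (d := 8 * (η * s ^ 2) ^ 2)
    (by positivity) fun x => ?_).trans (ENNReal.ofReal_le_ofReal ?_)
  · obtain ⟨w, hw⟩ : ∃ w, w = x ^ 2 / s ^ 2 := ⟨_, rfl⟩
    have hw0 : 0 ≤ w := by rw [hw]; positivity
    have hx : η * x ^ 2 = η * s ^ 2 * w := by rw [hw]; field_simp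
    have habs : |η * x ^ 2| ≤ w / 2 := by
      rw [hx, abs_mul, abs_mul, abs_of_nonneg (sq_nonneg s), abs_of_nonneg hw0]
      nlinarith
    calc Real.exp (η * x ^ 2)
        ≤ 1 + η * x ^ 2 + (η * x ^ 2) ^ 2 * Real.exp (w / 2) :=
          (exp_le_quadratic_mul_exp_abs _).trans (by gcongr)
      _ = 1 + η * x ^ 2 + (η * s ^ 2) ^ 2 * (w ^ 2 * Real.exp (w / 2)) := by rw [hx]; ring
      _ ≤ 1 + η * x ^ 2 + (η * s ^ 2) ^ 2 * (8 * Real.exp w) := by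
          gcongr 1 + η * x ^ 2 + (η * s ^ 2) ^ 2 * ?_
          exact sq_mul_exp_half_le hw0
      _ = _ := by rw [hw]; ring
  · linarith [Real.add_one_le_exp (η + 16 * s ^ 4 * η ^ 2)]

theorem lintegral_exp_mul_add_mul_sq_le (h : IsStdSubGaussian s ν) (α : ℝ) {η : ℝ}
    (hη : |η| * s ^ 2 ≤ 1 / 4) :
    ∫⁻ x, ENNReal.ofReal (Real.exp (α * x + η * x ^ 2)) ∂ν
      ≤ ENNReal.ofReal (Real.exp (2 * s ^ 2 * α ^ 2 + η + 32 * s ^ 4 * η ^ 2)) := by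
  have hpow (u v : ℝ) : ENNReal.ofReal (Real.exp u) ^ v = ENNReal.ofReal (Real.exp (v * u)) := by
    rw [ENNReal.ofReal_rpow_of_pos (Real.exp_pos u), ← Real.exp_mul, mul_comm]
  have hCS := ENNReal.lintegral_mul_le_Lp_mul_Lq ν Real.HolderConjugate.two_two
    (f := fun x => ENNReal.ofReal (Real.exp (α * x)))
    (g := fun x => ENNReal.ofReal (Real.exp (η * x ^ 2))) (by fun_prop) (by fun_prop)
  simp only [Pi.mul_apply, hpow, ← ENNReal.ofReal_mul (Real.exp_pos _).le, ← Real.exp_add,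
    ← mul_assoc] at hCS
  have hlin := h.lintegral_exp_mul_le (2 * α)
  have hsq := h.lintegral_exp_mul_sq_le (η := 2 * η) (by rw [abs_mul, abs_two]; linarith)
  refine hCS.trans ((mul_le_mul' (ENNReal.rpow_le_rpow hlin (by norm_num))
    (ENNReal.rpow_le_rpow hsq (by norm_num))).trans_eq ?_)
  rw [hpow, hpow, ← ENNReal.ofReal_mul (Real.exp_pos _).le, ← Real.exp_add]
  ring_nf

end IsStdSubGaussian

section HansonWright

open scoped InnerProductSpace

variable {ι : Type*} {H : Type*} [NormedAddCommGroup H] [InnerProductSpace ℝ H]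

/-- `y` is a Bessel family with bound `b`, that is, `‖∑ j, x j • y j‖ ^ 2 ≤ b * ∑ j, x j ^ 2`. -/
structure IsBessel [Fintype ι] (b : ℝ) (y : ι → H) : Prop where
  nonneg : 0 ≤ b
  sum_inner_sq_le : ∀ u, ∑ j, ⟪y j, u⟫_ℝ ^ 2 ≤ b * ‖u‖ ^ 2

/-- `W` is a symmetric right inverse of `1 - c ∑ j ∈ t, y j ⊗ y j`. Up to the factor `θ`, it is the
quadratic form left in the exponent of `exp (θ ‖∑ j, x j • y j‖ ^ 2)` after integrating out the
coordinates in `t`. -/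
structure IsFrameResolvent (c : ℝ) (y : ι → H) (t : Finset ι) (W : H →ₗ[ℝ] H) : Prop where
  isSymmetric : W.IsSymmetric
  right_inv : ∀ u, W u - c • ∑ j ∈ t, ⟪y j, W u⟫_ℝ • y j = u

/-- The Sherman–Morrison update of a symmetric `W`: it turns an inverse of `V` into an inverse of
`V - c v ⊗ v`. -/
noncomputable def shermanMorrison (c : ℝ) (v : H) (W : H →ₗ[ℝ] H) : H →ₗ[ℝ] H :=
  W + (c / (1 - c * ⟪v, W v⟫_ℝ)) • (innerₗ H (W v)).smulRight (W v)

theorem shermanMorrison_apply (c : ℝ) (v : H) (W : H →ₗ[ℝ] H) (u : H) :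
    shermanMorrison c v W u = W u + (c / (1 - c * ⟪v, W v⟫_ℝ) * ⟪W v, u⟫_ℝ) • W v := by
  simp [shermanMorrison, mul_smul]

theorem inner_shermanMorrison (c : ℝ) (v : H) (W : H →ₗ[ℝ] H) (u : H) :
    ⟪u, shermanMorrison c v W u⟫_ℝ
      = ⟪u, W u⟫_ℝ + c / (1 - c * ⟪v, W v⟫_ℝ) * ⟪W v, u⟫_ℝ ^ 2 := by
  rw [shermanMorrison_apply, inner_add_right, real_inner_smul_right, real_inner_comm u (W v)]
  ring

theorem isFrameResolvent_empty (c : ℝ) (y : ι → H) :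
    IsFrameResolvent c y ∅ LinearMap.id :=
  ⟨fun _ _ => rfl, fun _ => by simp⟩

theorem IsBessel.mono [Fintype ι] {b b' : ℝ} {y : ι → H} (hy : IsBessel b y)
    (h : b ≤ b') : IsBessel b' y where
  nonneg := hy.nonneg.trans h
  sum_inner_sq_le u := (hy.sum_inner_sq_le u).trans (by gcongr)

theorem IsBessel.norm_sq_le [Fintype ι] {b : ℝ} {y : ι → H} (hy : IsBessel b y) (j : ι) :
    ‖y j‖ ^ 2 ≤ b := by
  have h := (Finset.single_le_sum (f := fun k => ⟪y k, y j⟫_ℝ ^ 2) (fun _ _ => sq_nonneg _)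
    (Finset.mem_univ j)).trans (hy.sum_inner_sq_le (y j))
  simp only [real_inner_self_eq_norm_sq] at h
  rcases (sq_nonneg ‖y j‖).eq_or_lt with h0 | h0
  · exact h0 ▸ hy.nonneg
  · exact le_of_mul_le_mul_right (by rwa [sq (‖y j‖ ^ 2)] at h) h0

theorem IsBessel.abs_sum_inner_mul_inner_le [Fintype ι] {b : ℝ} {y : ι → H} (hy : IsBessel b y)
    (t : Finset ι) (u w : H) : |∑ j ∈ t, ⟪y j, u⟫_ℝ * ⟪y j, w⟫_ℝ| ≤ b * ‖u‖ * ‖w‖ := by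
  have hle (z : H) : ∑ j ∈ t, ⟪y j, z⟫_ℝ ^ 2 ≤ b * ‖z‖ ^ 2 :=
    (Finset.sum_le_univ_sum_of_nonneg fun _ => sq_nonneg _).trans (hy.sum_inner_sq_le z)
  have hb := hy.nonneg
  refine abs_le_of_sq_le_sq ?_ (by positivity)
  calc (∑ j ∈ t, ⟪y j, u⟫_ℝ * ⟪y j, w⟫_ℝ) ^ 2
      ≤ (∑ j ∈ t, ⟪y j, u⟫_ℝ ^ 2) * ∑ j ∈ t, ⟪y j, w⟫_ℝ ^ 2 :=
        Finset.sum_mul_sq_le_sq_mul_sq _ _ _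
    _ ≤ (b * ‖u‖ ^ 2) * (b * ‖w‖ ^ 2) :=
        mul_le_mul (hle u) (hle w) (Finset.sum_nonneg fun _ _ => sq_nonneg _) (by positivity)
    _ = (b * ‖u‖ * ‖w‖) ^ 2 := by ring

namespace IsFrameResolvent

variable {c b : ℝ} {y : ι → H} {t : Finset ι} {W : H →ₗ[ℝ] H}

theorem insert_shermanMorrison [DecidableEq ι] (hW : IsFrameResolvent c y t W) {i : ι} (hi : i ∉ t)
    (hc : 1 - c * ⟪y i, W (y i)⟫_ℝ ≠ 0) :
    IsFrameResolvent c y (insert i t) (shermanMorrison c (y i) W) where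
  isSymmetric u w := by
    rw [shermanMorrison_apply, shermanMorrison_apply, inner_add_left, inner_add_right,
      hW.isSymmetric u w, real_inner_smul_left, real_inner_smul_right, real_inner_comm u (W (y i))]
    ring
  right_inv u := by
    obtain ⟨k, hk⟩ : ∃ k, k = c / (1 - c * ⟪y i, W (y i)⟫_ℝ) * ⟪W (y i), u⟫_ℝ := ⟨_, rfl⟩
    have hk' : k = c * ⟪y i, W u⟫_ℝ + c * k * ⟪y i, W (y i)⟫_ℝ := by
      rw [← hW.isSymmetric (y i) u, hk]
      field_simp
      ring
    have hsplit : shermanMorrison c (y i) W u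
        - c • ∑ j ∈ insert i t, ⟪y j, shermanMorrison c (y i) W u⟫_ℝ • y j
        = (W u - c • ∑ j ∈ t, ⟪y j, W u⟫_ℝ • y j)
          + k • (W (y i) - c • ∑ j ∈ t, ⟪y j, W (y i)⟫_ℝ • y j)
          - (c * ⟪y i, W u⟫_ℝ + c * k * ⟪y i, W (y i)⟫_ℝ) • y i := by
      simp only [shermanMorrison_apply, ← hk, Finset.sum_insert hi, inner_add_right,
        real_inner_smul_right, add_smul, Finset.sum_add_distrib, mul_smul, ← Finset.smul_sum]
      module
    rw [hsplit, hW.right_inv, hW.right_inv, ← hk', add_sub_cancel_right]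

theorem inner_apply (hW : IsFrameResolvent c y t W) (u w : H) :
    ⟪w, W u⟫_ℝ = ⟪w, u⟫_ℝ + c * ∑ j ∈ t, ⟪y j, W u⟫_ℝ * ⟪y j, w⟫_ℝ := by
  have hcomm (j : ι) : ⟪w, y j⟫_ℝ = ⟪y j, w⟫_ℝ := real_inner_comm _ _
  have h := congrArg (inner ℝ w) (hW.right_inv u)
  simp only [inner_sub_right, real_inner_smul_right, inner_sum, hcomm] at h
  linarith

variable [Fintype ι]

theorem norm_apply_le (hW : IsFrameResolvent c y t W) (hy : IsBessel b y) (hc : |c| * b ≤ 1 / 4)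
    (u : H) : ‖W u‖ ≤ 2 * ‖u‖ := by
  have hsum := hy.abs_sum_inner_mul_inner_le t (W u) (W u)
  have h : ‖W u‖ ^ 2 ≤ ‖W u‖ * ‖u‖ + 1 / 4 * ‖W u‖ ^ 2 := calc
    ‖W u‖ ^ 2 = ⟪W u, u⟫_ℝ + c * ∑ j ∈ t, ⟪y j, W u⟫_ℝ * ⟪y j, W u⟫_ℝ := by
        rw [← hW.inner_apply, real_inner_self_eq_norm_sq]
    _ ≤ ‖W u‖ * ‖u‖ + |c| * (b * ‖W u‖ * ‖W u‖) := by
        refine add_le_add (real_inner_le_norm _ _) ((le_abs_self _).trans ?_)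
        rw [abs_mul]
        gcongr
    _ ≤ ‖W u‖ * ‖u‖ + 1 / 4 * ‖W u‖ ^ 2 := by nlinarith [sq_nonneg ‖W u‖]
  nlinarith [norm_nonneg u, norm_nonneg (W u)]

theorem abs_inner_sub_norm_sq_le (hW : IsFrameResolvent c y t W) (hy : IsBessel b y)
    (hc : |c| * b ≤ 1 / 4) (u : H) : |⟪u, W u⟫_ℝ - ‖u‖ ^ 2| ≤ 2 * (|c| * b) * ‖u‖ ^ 2 := by
  have hb := hy.nonneg
  calc |⟪u, W u⟫_ℝ - ‖u‖ ^ 2| = |c| * |∑ j ∈ t, ⟪y j, W u⟫_ℝ * ⟪y j, u⟫_ℝ| := by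
        rw [hW.inner_apply, real_inner_self_eq_norm_sq, add_sub_cancel_left, abs_mul]
    _ ≤ |c| * (b * (2 * ‖u‖) * ‖u‖) := by
        gcongr
        exact (hy.abs_sum_inner_mul_inner_le t (W u) u).trans
          (by gcongr; exact hW.norm_apply_le hy hc u)
    _ = 2 * (|c| * b) * ‖u‖ ^ 2 := by ring

theorem abs_mul_inner_le (hW : IsFrameResolvent c y t W) (hy : IsBessel b y)
    (hc : |c| * b ≤ 1 / 4) (i : ι) : |c * ⟪y i, W (y i)⟫_ℝ| ≤ 1 / 2 := calc
  |c * ⟪y i, W (y i)⟫_ℝ| ≤ |c| * (‖y i‖ * (2 * ‖y i‖)) := by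
    rw [abs_mul]
    gcongr
    exact (abs_real_inner_le_norm _ _).trans (by gcongr; exact hW.norm_apply_le hy hc _)
  _ = 2 * (|c| * ‖y i‖ ^ 2) := by ring
  _ ≤ 2 * (|c| * b) := by gcongr; exact hy.norm_sq_le i
  _ ≤ 1 / 2 := by linarith

end IsFrameResolvent

theorem riccati_increment_le {s b θ a g N : ℝ} (hs : 1 ≤ s ^ 2) (hb : |16 * s ^ 2 * θ| * b ≤ 1 / 4)
    (hN : 0 ≤ N) (hNb : N ≤ b) (hg : |g - N| ≤ 2 * (|16 * s ^ 2 * θ| * b) * N)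
    (hqg : |16 * s ^ 2 * θ * g| ≤ 1 / 2) :
    2 * s ^ 2 * (2 * θ * a) ^ 2 + θ * g + 32 * s ^ 4 * (θ * g) ^ 2
      ≤ θ * (16 * s ^ 2 * θ / (1 - 16 * s ^ 2 * θ * g) * a ^ 2)
        + (θ + 128 * s ^ 4 * θ ^ 2 * b) * N := by
  have hden : 0 < 1 - 16 * s ^ 2 * θ * g := by linarith [(abs_le.1 hqg).2]
  -- The factor `16` absorbs the cost `8 s² θ² a²` of the linear term: `1 - c g ≤ 3 / 2 ≤ 16 / 8`.
  have hlinear : 2 * s ^ 2 * (2 * θ * a) ^ 2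
      ≤ θ * (16 * s ^ 2 * θ / (1 - 16 * s ^ 2 * θ * g) * a ^ 2) := by
    have e : θ * (16 * s ^ 2 * θ / (1 - 16 * s ^ 2 * θ * g) * a ^ 2)
        = 16 * (s * θ * a) ^ 2 / (1 - 16 * s ^ 2 * θ * g) := by ring
    rw [e, le_div_iff₀ hden]
    nlinarith [sq_nonneg (s * θ * a), (abs_le.1 hqg).1]
  have hdiag : θ * g ≤ θ * N + 32 * s ^ 4 * θ ^ 2 * b * N := by
    have h : θ * (g - N) ≤ |θ| * (2 * (|16 * s ^ 2 * θ| * b) * N) :=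
      (le_abs_self _).trans (by rw [abs_mul]; gcongr)
    have e : |θ| * (2 * (|16 * s ^ 2 * θ| * b) * N) = 32 * (s ^ 2 * 1) * θ ^ 2 * b * N := by
      rw [abs_mul, abs_of_nonneg (by positivity : 0 ≤ 16 * s ^ 2), ← sq_abs θ]
      ring
    have hs4 : 32 * (s ^ 2 * 1) * θ ^ 2 * b * N ≤ 32 * (s ^ 2 * s ^ 2) * θ ^ 2 * b * N := by
      have := hN.trans hNb
      gcongr
    linarith
  have hsquare : g ^ 2 ≤ 3 * (b * N) := by
    obtain ⟨h₁, h₂⟩ := abs_le.1 (hg.trans (by gcongr : _ ≤ 2 * (1 / 4) * N))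
    nlinarith
  nlinarith [mul_le_mul_of_nonneg_left hsquare (by positivity : 0 ≤ 32 * s ^ 4 * θ ^ 2)]

variable [Fintype ι] {s b θ : ℝ} {y : ι → H}

theorem IsStdSubGaussian.lintegral_exp_inner_resolvent_le {ν : Measure ℝ} [IsProbabilityMeasure ν]
    (h : IsStdSubGaussian s ν) (hy : IsBessel b y) (hθ : |16 * s ^ 2 * θ| * b ≤ 1 / 4)
    {t : Finset ι} {W : H →ₗ[ℝ] H} (hW : IsFrameResolvent (16 * s ^ 2 * θ) y t W) (i : ι) (u : H) :
    ∫⁻ x, ENNReal.ofReal (Real.exp (θ * ⟪u + x • y i, W (u + x • y i)⟫_ℝ)) ∂ν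
      ≤ ENNReal.ofReal (Real.exp (θ * ⟪u, shermanMorrison (16 * s ^ 2 * θ) (y i) W u⟫_ℝ
          + (θ + 128 * s ^ 4 * θ ^ 2 * b) * ‖y i‖ ^ 2)) := by
  have hexpand (x : ℝ) : θ * ⟪u + x • y i, W (u + x • y i)⟫_ℝ = θ * ⟪u, W u⟫_ℝ
      + (2 * θ * ⟪W (y i), u⟫_ℝ * x + θ * ⟪y i, W (y i)⟫_ℝ * x ^ 2) := by
    simp only [map_add, map_smul, inner_add_left, inner_add_right, real_inner_smul_left,
      real_inner_smul_right, ← hW.isSymmetric (y i) u, real_inner_comm (W (y i)) u]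
    ring
  have hqg := hW.abs_mul_inner_le hy hθ i
  have hsmall : |θ * ⟪y i, W (y i)⟫_ℝ| * s ^ 2 ≤ 1 / 4 := by
    have e : |16 * s ^ 2 * θ * ⟪y i, W (y i)⟫_ℝ| = 16 * (|θ * ⟪y i, W (y i)⟫_ℝ| * s ^ 2) := by
      rw [mul_assoc, abs_mul, abs_of_nonneg (by positivity : 0 ≤ 16 * s ^ 2)]
      ring
    linarith
  simp only [hexpand, Real.exp_add (θ * ⟪u, W u⟫_ℝ), ENNReal.ofReal_mul (Real.exp_pos _).le]
  rw [lintegral_const_mul _ (by fun_prop), inner_shermanMorrison]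
  refine (mul_le_mul_right (h.lintegral_exp_mul_add_mul_sq_le _ hsmall) _).trans ?_
  rw [← ENNReal.ofReal_mul (Real.exp_pos _).le, ← Real.exp_add]
  refine ENNReal.ofReal_le_ofReal (Real.exp_le_exp.2 ?_)
  linarith [riccati_increment_le (a := ⟪W (y i), u⟫_ℝ) h.one_le_sq hθ (sq_nonneg ‖y i‖)
    (hy.norm_sq_le i) (hW.abs_inner_sub_norm_sq_le hy hθ (y i)) hqg]

theorem sum_compl_update_smul [DecidableEq ι] {t : Finset ι} {i : ι} (hi : i ∉ t) (x : ι → ℝ)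
    (u : ℝ) :
    ∑ j ∈ tᶜ, Function.update x i u j • y j = ∑ j ∈ (insert i t)ᶜ, x j • y j + u • y i := by
  rw [← Finset.insert_compl_insert hi, Finset.sum_insert (by simp), Function.update_self, add_comm]
  congr 1
  refine Finset.sum_congr rfl fun j hj => ?_
  rw [Function.update_of_ne (fun hji => by simp [hji] at hj)]

variable {ν : ι → Measure ℝ} [∀ i, IsProbabilityMeasure (ν i)]

theorem exists_lmarginal_exp_norm_sq_le [DecidableEq ι] (h : ∀ i, IsStdSubGaussian s (ν i))
    (hy : IsBessel b y) (hθ : |16 * s ^ 2 * θ| * b ≤ 1 / 4) (t : Finset ι) :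
    ∃ W, IsFrameResolvent (16 * s ^ 2 * θ) y t W ∧ ∀ x,
      lmarginal ν t (fun x => ENNReal.ofReal (Real.exp (θ * ‖∑ j, x j • y j‖ ^ 2))) x
        ≤ ENNReal.ofReal (Real.exp (θ * ⟪∑ j ∈ tᶜ, x j • y j, W (∑ j ∈ tᶜ, x j • y j)⟫_ℝ
            + (θ + 128 * s ^ 4 * θ ^ 2 * b) * ∑ j ∈ t, ‖y j‖ ^ 2)) := by
  induction t using Finset.induction_on with
  | empty => exact ⟨_, isFrameResolvent_empty _ y, fun x => by simp⟩
  | insert i t hi ih =>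
    obtain ⟨W, hW, hle⟩ := ih
    have hne := hW.abs_mul_inner_le hy hθ i
    refine ⟨_, hW.insert_shermanMorrison hi (by linarith [(abs_le.1 hne).2]), fun x => ?_⟩
    have hmeas : Measurable fun x : ι → ℝ =>
        ENNReal.ofReal (Real.exp (θ * ‖∑ j, x j • y j‖ ^ 2)) := by
      have : Continuous fun x : ι → ℝ => Real.exp (θ * ‖∑ j, x j • y j‖ ^ 2) := by fun_prop
      exact this.measurable.ennreal_ofReal
    obtain ⟨u, hu⟩ : ∃ u, u = ∑ j ∈ (insert i t)ᶜ, x j • y j := ⟨_, rfl⟩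
    rw [lmarginal_insert _ hmeas hi, Finset.sum_insert hi, mul_add, ← add_assoc, ← hu, Real.exp_add,
      ENNReal.ofReal_mul (Real.exp_pos _).le]
    refine (lintegral_mono fun v => hle (Function.update x i v)).trans ?_
    simp only [sum_compl_update_smul hi, ← hu, Real.exp_add _ (_ * ∑ _ ∈ t, _),
      ENNReal.ofReal_mul (Real.exp_pos _).le]
    rw [lintegral_mul_const' _ _ ENNReal.ofReal_ne_top]
    gcongr
    exact (h i).lintegral_exp_inner_resolvent_le hy hθ hW i u

theorem lintegral_exp_norm_sq_le (h : ∀ i, IsStdSubGaussian s (ν i)) (hy : IsBessel b y)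
    (hθ : |16 * s ^ 2 * θ| * b ≤ 1 / 4) :
    ∫⁻ x, ENNReal.ofReal (Real.exp (θ * ‖∑ j, x j • y j‖ ^ 2)) ∂Measure.pi ν
      ≤ ENNReal.ofReal (Real.exp ((θ + 128 * s ^ 4 * θ ^ 2 * b) * ∑ j, ‖y j‖ ^ 2)) := by
  classical
  obtain ⟨W, -, hle⟩ := exists_lmarginal_exp_norm_sq_le h hy hθ Finset.univ
  rw [lintegral_eq_lmarginal_univ 0]
  simpa using hle 0

theorem measure_ge_le_of_lintegral_exp_le {α : Type*} [MeasurableSpace α] {ρ : Measure α}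
    {f : α → ℝ} (hf : Measurable f) {c : ℝ}
    (h : ∫⁻ a, ENNReal.ofReal (Real.exp (f a)) ∂ρ ≤ ENNReal.ofReal (Real.exp c)) (t : ℝ) :
    ρ {a | t ≤ f a} ≤ ENNReal.ofReal (Real.exp (c - t)) := by
  have hexp := ENNReal.ofReal_pos.2 (Real.exp_pos t)
  calc ρ {a | t ≤ f a}
      ≤ ρ {a | ENNReal.ofReal (Real.exp t) ≤ ENNReal.ofReal (Real.exp (f a))} :=
        measure_mono fun a ha => ENNReal.ofReal_le_ofReal (Real.exp_le_exp.2 ha)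
    _ ≤ (∫⁻ a, ENNReal.ofReal (Real.exp (f a)) ∂ρ) / ENNReal.ofReal (Real.exp t) :=
        meas_ge_le_lintegral_div (by fun_prop) hexp.ne' ENNReal.ofReal_ne_top
    _ ≤ ENNReal.ofReal (Real.exp c) / ENNReal.ofReal (Real.exp t) := by gcongr
    _ = ENNReal.ofReal (Real.exp (c - t)) := by
        rw [← ENNReal.ofReal_div_of_pos (Real.exp_pos t), ← Real.exp_sub]

theorem measure_norm_sq_notMem_Icc_le (h : ∀ i, IsStdSubGaussian s (ν i)) (hs : 1 ≤ s)
    (hy : IsBessel b y) (hb : 0 < b) {τ : ℝ} (hτ : ∑ j, ‖y j‖ ^ 2 = τ) :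
    Measure.pi ν {x | ‖∑ j, x j • y j‖ ^ 2 ∉ Set.Icc (τ / 2) (3 * τ / 2)}
      ≤ 2 * ENNReal.ofReal (Real.exp (-(τ / (2048 * s ^ 4 * b)))) := by
  -- With `θ = ± l`, the error term `128 s⁴ θ² b τ` is `l τ / 4`, half of the deviation `l τ / 2`.
  obtain ⟨l, hl⟩ : ∃ l, l = 1 / (512 * s ^ 4 * b) := ⟨_, rfl⟩
  have hl0 : 0 < l := by rw [hl]; positivity
  have htail (θ : ℝ) (hθ : |θ| = l) :
      Measure.pi ν {x | θ * τ + l * τ / 2 ≤ θ * ‖∑ j, x j • y j‖ ^ 2}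
        ≤ ENNReal.ofReal (Real.exp (-(τ / (2048 * s ^ 4 * b)))) := by
    have hcont : Continuous fun x : ι → ℝ => θ * ‖∑ j, x j • y j‖ ^ 2 := by fun_prop
    have hsmall : |16 * s ^ 2 * θ| * b ≤ 1 / 4 := by
      rw [abs_mul, hθ, hl, abs_of_nonneg (by positivity : 0 ≤ 16 * s ^ 2)]
      field_simp
      nlinarith [one_le_pow₀ hs (n := 2)]
    have hmgf := lintegral_exp_norm_sq_le h hy hsmall
    rw [hτ] at hmgf
    refine (measure_ge_le_of_lintegral_exp_le hcont.measurable hmgf _).trans_eq ?_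
    rw [← sq_abs θ, hθ, hl]
    congr 2
    field_simp
    ring
  rw [two_mul]
  refine le_trans (measure_mono fun x hx => ?_) ((measure_union_le _ _).trans
    (add_le_add (htail l (abs_of_pos hl0)) (htail (-l) (by rw [abs_neg, abs_of_pos hl0]))))
  simp only [Set.mem_union, Set.mem_ofPred_eq, Set.mem_Icc, not_and_or, not_le] at hx ⊢
  exact hx.symm.imp (fun hx => by nlinarith) fun hx => by nlinarith

end HansonWright

section Nets

open Metric Module

variable {V W : Type*} [NormedAddCommGroup V] [NormedSpace ℝ V] [NormedAddCommGroup W]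
  [NormedSpace ℝ W] {ε : ℝ≥0}

theorem card_le_of_isSeparated_of_subset_closedBall [FiniteDimensional ℝ V] (hε : 0 < ε)
    {N : Finset V} (hsep : IsSeparated ε (N : Set V)) {x : V} {r : ℝ} (hr : 0 ≤ r)
    (hN : (N : Set V) ⊆ closedBall x r) :
    (N.card : ℝ) ≤ (1 + 2 * r / ε) ^ finrank ℝ V := by
  borelize V
  have hε' : (0 : ℝ) < ε := hε
  have hdisj : (N : Set V).PairwiseDisjoint fun v => ball v (ε / 2) := fun v hv w hw hvw => by
    refine ball_disjoint_ball ?_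
    have h : (ε : ℝ≥0∞) < edist v w := hsep hv hw hvw
    rw [edist_dist, ENNReal.coe_nnreal_eq, ENNReal.ofReal_lt_ofReal_iff_of_nonneg hε'.le] at h
    linarith
  have hsub : ⋃ v ∈ N, ball v (ε / 2 : ℝ) ⊆ ball x (r + ε / 2) := Set.iUnion₂_subset fun v hv =>
    ball_subset_ball' (by linarith [mem_closedBall.1 (hN hv)])
  let μ : Measure V := Measure.addHaar
  have hvol : (N.card : ℝ≥0∞) * ENNReal.ofReal ((ε / 2 : ℝ) ^ finrank ℝ V) * μ (ball 0 1)
      ≤ ENNReal.ofReal ((r + ε / 2) ^ finrank ℝ V) * μ (ball 0 1) := by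
    calc _ = μ (⋃ v ∈ N, ball v (ε / 2)) := by
          rw [measure_biUnion_finset hdisj fun _ _ => measurableSet_ball]
          simp only [μ.addHaar_ball_of_pos _ (half_pos hε'), Finset.sum_const, nsmul_eq_mul,
            mul_assoc]
      _ ≤ μ (ball x (r + ε / 2)) := measure_mono hsub
      _ = _ := μ.addHaar_ball_of_pos _ (by positivity)
  have hcard := ENNReal.toReal_le_of_le_ofReal (by positivity)
    ((ENNReal.mul_le_mul_iff_left (measure_ball_pos _ _ one_pos).ne' measure_ball_lt_top.ne).1 hvol)
  rw [ENNReal.toReal_mul, ENNReal.toReal_natCast, ENNReal.toReal_ofReal (by positivity),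
    ← le_div_iff₀ (by positivity), ← div_pow] at hcard
  rwa [show 1 + 2 * r / ε = (r + ε / 2) / (ε / 2) by field_simp; ring]

theorem exists_finset_isCover_card_le [FiniteDimensional ℝ V] (hε : 0 < ε) {s : Set V}
    (hs : IsCompact s) {x : V} {r : ℝ} (hr : 0 ≤ r) (hsr : s ⊆ closedBall x r) :
    ∃ N : Finset V, ↑N ⊆ s ∧ IsCover ε s N ∧ (N.card : ℝ) ≤ (1 + 2 * r / ε) ^ finrank ℝ V := by
  have hfin : packingNumber ε s ≠ ⊤ := by
    obtain ⟨C, -, hC, hcov⟩ := exists_finite_isCover_of_isCompact (half_pos hε).ne' hs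
    refine ne_top_of_le_ne_top (Set.encard_ne_top_iff.2 hC) (le_trans ?_
      hcov.externalCoveringNumber_le_encard)
    simpa only [mul_div_cancel₀ ε two_ne_zero]
      using packingNumber_two_mul_le_externalCoveringNumber (ε / 2) s
  have hNfin : (maximalSeparatedSet ε s).Finite :=
    Set.encard_ne_top_iff.1 ((encard_maximalSeparatedSet hfin).trans_ne hfin)
  refine ⟨hNfin.toFinset, ?_, ?_, card_le_of_isSeparated_of_subset_closedBall hε ?_ hr
    (Set.Subset.trans ?_ hsr)⟩ <;> rw [hNfin.coe_toFinset]
  exacts [maximalSeparatedSet_subset, isCover_maximalSeparatedSet hfin,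
    isSeparated_maximalSeparatedSet, maximalSeparatedSet_subset]

variable {N : Set V} (D : V →L[ℝ] W)

theorem norm_apply_le_add_of_isCover_sphere (hcov : IsCover ε (sphere 0 1) N) {u : V}
    (hu : ‖u‖ = 1) : ∃ v ∈ N, ‖D u‖ ≤ ‖D v‖ + ε * ‖D‖ ∧ ‖D v‖ ≤ ‖D u‖ + ε * ‖D‖ := by
  obtain ⟨v, hv, huv⟩ := hcov (mem_sphere_zero_iff_norm.2 hu)
  have hdist : ‖D u - D v‖ ≤ ε * ‖D‖ := by
    rw [← map_sub, mul_comm]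
    refine (D.le_opNorm _).trans (mul_le_mul_of_nonneg_left ?_ (norm_nonneg _))
    rw [← dist_eq_norm]
    exact edist_le_coe.1 huv
  refine ⟨v, hv, ?_, ?_⟩ <;> linarith [abs_le.1 (abs_norm_sub_norm_le (D u) (D v))]

theorem norm_le_of_isCover_sphere (hε : ε < 1) (hcov : IsCover ε (sphere 0 1) N) {c : ℝ}
    (hc : 0 ≤ c) (hN : ∀ v ∈ N, ‖D v‖ ≤ c) : ‖D‖ ≤ c / (1 - ε) := by
  have hle : ‖D‖ ≤ c + ε * ‖D‖ := D.opNorm_le_of_unit_norm (by positivity) fun u hu => by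
    obtain ⟨v, hv, hle, -⟩ := norm_apply_le_add_of_isCover_sphere D hcov hu
    linarith [hN v hv]
  rw [le_div_iff₀ (sub_pos.2 (NNReal.coe_lt_one.2 hε))]
  linarith

theorem le_norm_apply_sq_of_isCover_sphere (hcov : IsCover (1 / 8) (sphere 0 1) N) {τ : ℝ}
    (hτ : 0 < τ) (hN : ∀ v ∈ N, ‖D v‖ ^ 2 ∈ Set.Icc (τ / 2) (3 * τ / 2)) {u : V} (hu : ‖u‖ = 1) :
    τ / 4 ≤ ‖D u‖ ^ 2 := by
  -- `√(3 / 2) ≤ 5 / 4` and `7 / 10 ≤ √(1 / 2)`, so `‖D u‖ ≥ (7 / 10 - 1 / 8 * 8 / 7 * 5 / 4) √τ`.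
  have hr : 0 < √τ := Real.sqrt_pos.2 hτ
  have hrτ : √τ ^ 2 = τ := Real.sq_sqrt hτ.le
  have hD : ‖D‖ ≤ 5 / 4 * √τ / (1 - (1 / 8 : ℝ≥0)) :=
    norm_le_of_isCover_sphere D (by rw [← NNReal.coe_lt_coe]; norm_num) hcov (by positivity)
      fun v hv => le_of_sq_le_sq (by nlinarith [(hN v hv).2]) (by positivity)
  obtain ⟨v, hv, -, hle⟩ := norm_apply_le_add_of_isCover_sphere D hcov hu
  have hv' : 7 / 10 * √τ ≤ ‖D v‖ := le_of_sq_le_sq (by nlinarith [(hN v hv).1]) (norm_nonneg _)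
  norm_num at hD hle
  have hlow : 1 / 2 * √τ ≤ ‖D u‖ := by linarith
  nlinarith [hlow]

end Nets

section SingularValues

open scoped InnerProductSpace

variable {V W : Type*} [NormedAddCommGroup V] [InnerProductSpace ℝ V] [FiniteDimensional ℝ V]
  [NormedAddCommGroup W] [InnerProductSpace ℝ W] [FiniteDimensional ℝ W] {T : V →ₗ[ℝ] W} {t : ℝ}

theorem surjective_of_le_norm_adjoint_sq (ht : 0 < t)
    (h : ∀ u, t * ‖u‖ ^ 2 ≤ ‖T.adjoint u‖ ^ 2) : Function.Surjective T := by
  rw [← LinearMap.range_eq_top, ← Submodule.orthogonal_eq_bot_iff, LinearMap.orthogonal_range,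
    Submodule.eq_bot_iff]
  intro u hu
  have hu' := h u
  rw [LinearMap.mem_ker.1 hu, norm_zero, zero_pow two_ne_zero] at hu'
  exact norm_eq_zero.1 (pow_eq_zero_iff two_ne_zero |>.1 (by nlinarith [sq_nonneg ‖u‖]))

theorem le_sq_singularValues_of_le_norm_adjoint_sq (h : ∀ u, t * ‖u‖ ^ 2 ≤ ‖T.adjoint u‖ ^ 2)
    {i : ℕ} (hi : T.singularValues i ≠ 0) : t ≤ T.singularValues i ^ 2 := by
  have hiV : i < Module.finrank ℝ V := not_le.1 (mt T.singularValues_of_finrank_le hi)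
  obtain ⟨v, hv⟩ := (T.hasEigenvalue_adjoint_comp_self_sq_singularValues hiV).exists_hasEigenvector
  have hTTv : T.adjoint (T v) = (T.singularValues i ^ 2) • v := hv.apply_eq_smul
  have hTv : ‖T v‖ ^ 2 = T.singularValues i ^ 2 * ‖v‖ ^ 2 := by
    rw [← real_inner_self_eq_norm_sq, ← LinearMap.adjoint_inner_left, hTTv, real_inner_smul_left,
      real_inner_self_eq_norm_sq]
  have hpos : 0 < T.singularValues i ^ 2 * ‖v‖ ^ 2 := by have := norm_pos_iff.2 hv.2; positivity
  have hle := h (T v)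
  rw [hTTv, hTv, norm_smul, mul_pow, Real.norm_of_nonneg (sq_nonneg _)] at hle
  exact le_of_mul_le_mul_right (by linarith) hpos

end SingularValues

section NoiseTransport

open scoped InnerProductSpace

variable {ι κ V H : Type*} [Fintype ι] [Fintype κ] [NormedAddCommGroup V] [InnerProductSpace ℝ V]
  [NormedAddCommGroup H] [InnerProductSpace ℝ H]

variable (e : OrthonormalBasis κ ℝ V) (R : V →L[ℝ] H)

theorem sum_norm_sq_smul_apply (u : EuclideanSpace ℝ ι) :
    ∑ a : ι × κ, ‖u a.1 • R (e a.2)‖ ^ 2 = ‖u‖ ^ 2 * ∑ j, ‖R (e j)‖ ^ 2 := by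
  simp_rw [norm_smul, mul_pow, Fintype.sum_prod_type, ← Finset.mul_sum, ← Finset.sum_mul,
    Real.norm_eq_abs, sq_abs, ← EuclideanSpace.real_norm_sq_eq]

variable [CompleteSpace V] [CompleteSpace H]

theorem sum_inner_apply_sq (w : H) : ∑ j, ⟪R (e j), w⟫_ℝ ^ 2 = ‖R.adjoint w‖ ^ 2 := by
  simp_rw [← R.adjoint_inner_right]
  exact e.sum_sq_inner_right _

theorem isBessel_smul_apply (u : EuclideanSpace ℝ ι) :
    IsBessel (‖u‖ ^ 2 * ‖R‖ ^ 2) fun a : ι × κ => u a.1 • R (e a.2) where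
  nonneg := by positivity
  sum_inner_sq_le w := by
    simp_rw [real_inner_smul_left, mul_pow, Fintype.sum_prod_type, ← Finset.mul_sum,
      ← Finset.sum_mul, sum_inner_apply_sq, ← EuclideanSpace.real_norm_sq_eq, mul_assoc, ← mul_pow]
    gcongr
    exact (R.adjoint.le_opNorm w).trans_eq (by rw [LinearIsometryEquiv.norm_map])

theorem sum_norm_sq_sub_le_sum_norm_sq_starProjection_orthogonal (U : Submodule ℝ H)
    [FiniteDimensional ℝ U] :
    ∑ j, ‖R (e j)‖ ^ 2 - Module.finrank ℝ U * ‖R‖ ^ 2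
      ≤ ∑ j, ‖Uᗮ.starProjection (R (e j))‖ ^ 2 := by
  let q := stdOrthonormalBasis ℝ U
  have hproj (w : H) : ‖U.starProjection w‖ ^ 2 = ∑ k, ⟪w, q k⟫_ℝ ^ 2 := by
    rw [U.starProjection_apply, Submodule.norm_coe, ← q.sum_sq_inner_left]
    refine Finset.sum_congr rfl fun k _ => ?_
    rw [Submodule.coe_inner, ← U.starProjection_apply, U.inner_starProjection_left_eq_right,
      Submodule.starProjection_eq_self_iff.2 (q k).2]
  have hU : ∑ j, ‖U.starProjection (R (e j))‖ ^ 2 ≤ Module.finrank ℝ U * ‖R‖ ^ 2 := by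
    simp_rw [hproj]
    rw [Finset.sum_comm]
    simp_rw [sum_inner_apply_sq]
    refine (Finset.sum_le_card_nsmul _ _ (‖R‖ ^ 2) fun k _ => ?_).trans_eq (by simp)
    gcongr
    simpa using R.adjoint.le_opNorm (q k : H) |>.trans_eq (by
      rw [LinearIsometryEquiv.norm_map, Submodule.norm_coe, q.norm_eq_one, mul_one])
  simp_rw [U.norm_sq_eq_add_norm_sq_starProjection (R (e _)), Finset.sum_add_distrib]
  linarith

end NoiseTransport

section CovarianceRoot

variable {d : ℕ}

/-- The positive semi-definite root of `Q`, acting on the Euclidean space; it maps standardized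
noise to noise with covariance matrix `Q`. -/
noncomputable def sqrtCLM (Q : Matrix (Fin d) (Fin d) ℝ) :
    EuclideanSpace ℝ (Fin d) →L[ℝ] EuclideanSpace ℝ (Fin d) :=
  Matrix.toEuclideanCLM (n := Fin d) (𝕜 := ℝ) (matSqrt Q)

variable {Q : Matrix (Fin d) (Fin d) ℝ}

open scoped MatrixOrder in
theorem star_sqrtCLM_mul_sqrtCLM (hQ : Q.PosSemidef) :
    star (sqrtCLM Q) * sqrtCLM Q = Matrix.toEuclideanCLM (n := Fin d) (𝕜 := ℝ) Q := by
  have hstar : star (matSqrt Q) = matSqrt Q := (CFC.sqrt_nonneg Q).isSelfAdjoint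
  rw [sqrtCLM, ← map_star, ← map_mul, hstar, matSqrt, CFC.sqrt_mul_sqrt_self Q hQ.nonneg]

theorem norm_sqrtCLM_sq (hQ : Q.PosSemidef) : ‖sqrtCLM Q‖ ^ 2 = opNorm Q := by
  rw [sq, ← CStarRing.norm_star_mul_self, star_sqrtCLM_mul_sqrtCLM hQ, opNorm]

theorem sum_norm_sq_sqrtCLM (hQ : Q.PosSemidef) :
    ∑ j, ‖sqrtCLM Q (EuclideanSpace.basisFun (Fin d) ℝ j)‖ ^ 2 = Q.trace := by
  refine Finset.sum_congr rfl fun j _ => ?_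
  rw [← real_inner_self_eq_norm_sq, ← ContinuousLinearMap.adjoint_inner_right,
    ← ContinuousLinearMap.star_eq_adjoint, ← mul_apply_eq_comp,
    star_sqrtCLM_mul_sqrtCLM hQ, Matrix.inner_toEuclideanCLM]
  simp

end CovarianceRoot

section NoiseLaw

variable {Ω₀ Ω : Type*} [MeasurableSpace Ω₀] [MeasurableSpace Ω] {P₀ : Measure Ω₀} {P : Measure Ω}
  {n p : ℕ} {E : Ω₀ → Fin p → ℝ} {Es : Fin n → Ω → Fin p → ℝ} {M : ℝ}

theorem lintegral_exp_sq_div_le_of_psi2Norm_lt {U : Ω₀ → ℝ} {s : ℝ}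
    (h : psi2Norm P₀ U < ENNReal.ofReal s) :
    ∫⁻ ω, ENNReal.ofReal (Real.exp (U ω ^ 2 / s ^ 2)) ∂P₀ ≤ 2 := by
  have hs : 0 < s := ENNReal.ofReal_pos.1 (bot_le.trans_lt h)
  simp only [psi2Norm, iInf_lt_iff] at h
  obtain ⟨t, ht, hint, hts⟩ := h
  have hts' : (t : ℝ) ≤ s := by
    exact ENNReal.toReal_le_of_le_ofReal hs.le hts.le
  refine (lintegral_mono fun ω => ENNReal.ofReal_le_ofReal (Real.exp_le_exp.2 ?_)).trans hint
  exact div_le_div_of_nonneg_left (sq_nonneg _) (pow_pos ht 2) (pow_le_pow_left₀ t.2 hts' 2)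

theorem isStdSubGaussian_map [IsProbabilityMeasure P₀] {U : Ω₀ → ℝ} (hU : AEMeasurable U P₀)
    {s : ℝ} (hs : 0 < s) (hmean : ∫ ω, U ω ∂P₀ = 0) (hvar : variance U P₀ = 1)
    (hpsi : psi2Norm P₀ U < ENNReal.ofReal s) : IsStdSubGaussian s (P₀.map U) := by
  have hle := lintegral_exp_sq_div_le_of_psi2Norm_lt hpsi
  have hm : AEStronglyMeasurable (fun ω => Real.exp (U ω ^ 2 / s ^ 2)) P₀ :=
    AEMeasurable.aestronglyMeasurable (by fun_prop)
  have h0 : 0 ≤ᵐ[P₀] fun ω => Real.exp (U ω ^ 2 / s ^ 2) := .of_forall fun ω => (Real.exp_pos _).le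
  refine ⟨hs, ?_, ?_, ?_, ?_⟩
  · rwa [integral_map hU (by fun_prop)]
  · rw [integral_map hU (by fun_prop)]
    rw [variance_eq_integral hU, hmean] at hvar
    simpa using hvar
  · rw [integrable_map_measure (by fun_prop) hU]
    exact ⟨hm, (hasFiniteIntegral_iff_ofReal h0).2 (hle.trans_lt (by simp))⟩
  · rw [integral_map hU (by fun_prop), integral_eq_lintegral_of_nonneg_ae h0 hm]
    exact ENNReal.toReal_le_of_le_ofReal (by norm_num) (by simpa using hle)

theorem NoiseSubGaussian.exists_map_eq [IsProbabilityMeasure P₀] (hM : 0 < M)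
    (hE : NoiseSubGaussian P₀ E M) :
    ∃ ν : Fin p → Measure ℝ, (∀ j, IsProbabilityMeasure (ν j)) ∧
      (∀ j, IsStdSubGaussian (M + 1) (ν j)) ∧
      P₀.map E = (Measure.pi ν).map (matSqrt (covMat P₀ E)).mulVec := by
  obtain ⟨Et, hEt, hmeas, hind, hmean, hvar, hpsi⟩ := hE
  refine ⟨fun j => P₀.map fun ω => Et ω j, fun j => Measure.isProbabilityMeasure_map (hmeas j),
    fun j => isStdSubGaussian_map (hmeas j) (by linarith) (hmean j) (hvar j)
      ((hpsi j).trans_lt ((ENNReal.ofReal_lt_ofReal_iff (by linarith)).2 (lt_add_one M))), ?_⟩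
  rw [Measure.map_congr hEt, ← hind.map_fun_eq_pi_map hmeas,
    AEMeasurable.map_map_of_aemeasurable _ (aemeasurable_pi_lambda _ hmeas)]
  · rfl
  · exact (Continuous.matrix_mulVec continuous_const continuous_id).aemeasurable

theorem map_sample_eq_pi_map [IsProbabilityMeasure P₀] (hcopy : ∀ i, IdentDistrib (Es i) E P P₀)
    (hind : iIndepFun Es P) {ν : Fin p → Measure ℝ} [∀ j, IsProbabilityMeasure (ν j)]
    {S : (Fin p → ℝ) → Fin p → ℝ} (hS : Measurable S) (hlaw : P₀.map E = (Measure.pi ν).map S) :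
    P.map (fun ω i => Es i ω)
      = (Measure.pi fun a : Fin n × Fin p => ν a.2).map fun x i => S fun j => x (i, j) := by
  have hgrid : (Measure.pi fun a : Fin n × Fin p => ν a.2).map (MeasurableEquiv.curry _ _ ℝ)
      = Measure.pi fun _ : Fin n => Measure.pi ν := by
    simpa only [Measure.infinitePi_eq_pi]
      using Measure.infinitePi_map_curry (ι := Fin n) (X := ℝ) fun _ => ν
  rw [hind.map_fun_eq_pi_map fun i => (hcopy i).aemeasurable_fst]
  simp_rw [(hcopy _).map_eq, hlaw]
  rw [← Measure.pi_map_pi fun _ => hS.aemeasurable, ← hgrid,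
    Measure.map_map (by fun_prop) (MeasurableEquiv.measurable _)]
  rfl

end NoiseLaw

section RowCombination

variable {n p K : ℕ}

/-- The map `u ↦ Xᵀ u` between Euclidean spaces, which combines the rows of `X`, that is, the
observations. -/
noncomputable def rowCombination (X : Matrix (Fin n) (Fin p) ℝ) :
    EuclideanSpace ℝ (Fin n) →L[ℝ] EuclideanSpace ℝ (Fin p) :=
  (Matrix.toEuclideanLin X.transpose).toContinuousLinearMap

theorem rowCombination_apply (X : Matrix (Fin n) (Fin p) ℝ) (u : EuclideanSpace ℝ (Fin n)) :
    rowCombination X u = ∑ i, u i • WithLp.toLp 2 (X i) := by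
  ext j
  simp [rowCombination, Matrix.mulVec, dotProduct, mul_comm]

theorem adjoint_toEuclideanLin (X : Matrix (Fin n) (Fin p) ℝ) (u : EuclideanSpace ℝ (Fin n)) :
    (Matrix.toEuclideanLin X).adjoint u = rowCombination X u := by
  rw [← Matrix.toEuclideanLin_conjTranspose_eq_adjoint,
    Matrix.conjTranspose_eq_transpose_of_trivial]
  rfl

theorem starProjection_orthogonal_rowCombination_dataMatrix {Ω : Type*}
    (A : Matrix (Fin p) (Fin K) ℝ) (Zs : Fin n → Ω → Fin K → ℝ) (Es : Fin n → Ω → Fin p → ℝ)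
    (ω : Ω) (u : EuclideanSpace ℝ (Fin n)) :
    (LinearMap.range (Matrix.toEuclideanLin A))ᗮ.starProjection
        (rowCombination (dataMatrix A Zs Es ω) u)
      = (LinearMap.range (Matrix.toEuclideanLin A))ᗮ.starProjection
        (rowCombination (Matrix.of fun i => Es i ω) u) := by
  have hfactor (z : Fin K → ℝ) : (LinearMap.range (Matrix.toEuclideanLin A))ᗮ.starProjection
      (WithLp.toLp 2 (A.mulVec z)) = 0 :=
    Submodule.starProjection_orthogonal_apply_eq_zero ⟨WithLp.toLp 2 z, rfl⟩
  have hrow (i : Fin n) : dataMatrix A Zs Es ω i = A.mulVec (Zs i ω) + Es i ω := rfl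
  simp only [rowCombination_apply, map_sum, map_smul, hrow, WithLp.toLp_add, map_add, hfactor,
    zero_add]
  rfl

theorem mulVec_minNormEstimator_of_surjective {X : Matrix (Fin n) (Fin p) ℝ}
    (hX : Function.Surjective (Matrix.toEuclideanLin X)) (y : Fin n → ℝ) :
    X.mulVec (minNormEstimator X y) = y := by
  obtain ⟨u, hu⟩ := hX (WithLp.toLp 2 y)
  have hu' : X.mulVec u.ofLp = y := congrArg WithLp.ofLp hu
  have hle := (minNormEstimator_spec X y).1 u.ofLp
  rw [hu', sub_self, euclNorm, euclNorm, WithLp.toLp_zero, norm_zero, norm_le_zero_iff] at hle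
  exact sub_eq_zero.1 (congrArg WithLp.ofLp hle)

theorem sigma_ne_zero_of_surjective {X : Matrix (Fin n) (Fin p) ℝ} (hn : 0 < n)
    (hX : Function.Surjective (Matrix.toEuclideanLin X)) : sigma n X ≠ 0 := by
  rw [sigma, Ne, LinearMap.singularValues_eq_zero_iff_le_finrank_range,
    LinearMap.range_eq_top.2 hX, finrank_top, finrank_euclideanSpace_fin]
  omega

theorem le_sq_sigma_and_interpolates {X : Matrix (Fin n) (Fin p) ℝ} (hn : 0 < n) {t : ℝ}
    (ht : 0 < t) (h : ∀ u, ‖u‖ = 1 → t ≤ ‖rowCombination X u‖ ^ 2) :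
    t ≤ sigma n X ^ 2 ∧ ∀ y, X.mulVec (minNormEstimator X y) = y := by
  have hadj (u) : t * ‖u‖ ^ 2 ≤ ‖(Matrix.toEuclideanLin X).adjoint u‖ ^ 2 := by
    rw [adjoint_toEuclideanLin]
    rcases eq_or_ne u 0 with rfl | hu
    · simp
    · have hunit := h (‖u‖⁻¹ • u) (norm_smul_inv_norm hu)
      rw [map_smul, norm_smul, norm_inv, norm_norm, mul_pow, inv_pow, inv_mul_eq_div] at hunit
      exact (le_div_iff₀ (by have := norm_pos_iff.2 hu; positivity)).1 hunit
  have hsurj := surjective_of_le_norm_adjoint_sq ht hadj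
  exact ⟨le_sq_singularValues_of_le_norm_adjoint_sq hadj (sigma_ne_zero_of_surjective hn hsurj),
    mulVec_minNormEstimator_of_surjective hsurj⟩

end RowCombination

section Concentration

variable {Ω₀ Ω : Type*} [MeasurableSpace Ω₀] [MeasurableSpace Ω] {P₀ : Measure Ω₀} {P : Measure Ω}
  {n p : ℕ} {H : Type*} [NormedAddCommGroup H] [InnerProductSpace ℝ H]

theorem apply_rowCombination_matSqrt (D : EuclideanSpace ℝ (Fin p) →L[ℝ] H)
    (Q : Matrix (Fin p) (Fin p) ℝ) (u : EuclideanSpace ℝ (Fin n)) (x : Fin n × Fin p → ℝ) :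
    D (rowCombination (Matrix.of fun i => (matSqrt Q).mulVec fun j => x (i, j)) u)
      = ∑ a, x a • u a.1 • (D ∘L sqrtCLM Q) (EuclideanSpace.basisFun (Fin p) ℝ a.2) := by
  have hrow (i : Fin n) : WithLp.toLp 2 ((matSqrt Q).mulVec fun j => x (i, j))
      = ∑ j, x (i, j) • sqrtCLM Q (EuclideanSpace.basisFun (Fin p) ℝ j) := by
    have hsum := (EuclideanSpace.basisFun (Fin p) ℝ).sum_repr (WithLp.toLp 2 fun j => x (i, j))
    simp_rw [← map_smul, ← map_sum]
    exact congrArg (sqrtCLM Q) hsum.symm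
  rw [rowCombination_apply, map_sum, Fintype.sum_prod_type]
  refine Finset.sum_congr rfl fun i _ => ?_
  have hi := congrArg (fun w => D (u i • w)) (hrow i)
  simp only [map_smul, map_sum, Finset.smul_sum, smul_comm (u i)] at hi ⊢
  exact hi

variable [CompleteSpace H] {E : Ω₀ → Fin p → ℝ} {Es : Fin n → Ω → Fin p → ℝ} {M b τ : ℝ}

theorem measure_norm_sq_apply_rowCombination_notMem_Icc_le [IsProbabilityMeasure P₀] (hM : 0 < M)
    (hE : NoiseSubGaussian P₀ E M) (hcopy : ∀ i, IdentDistrib (Es i) E P P₀)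
    (hind : iIndepFun Es P) (D : EuclideanSpace ℝ (Fin p) →L[ℝ] H) (hb : 0 < b)
    (hD : ‖D ∘L sqrtCLM (covMat P₀ E)‖ ^ 2 ≤ b)
    (hτ : ∑ j, ‖D (sqrtCLM (covMat P₀ E) (EuclideanSpace.basisFun (Fin p) ℝ j))‖ ^ 2 = τ)
    {u : EuclideanSpace ℝ (Fin n)} (hu : ‖u‖ = 1) :
    P {ω | ‖D (rowCombination (Matrix.of fun i => Es i ω) u)‖ ^ 2 ∉ Set.Icc (τ / 2) (3 * τ / 2)}
      ≤ 2 * ENNReal.ofReal (Real.exp (-(τ / (2048 * (M + 1) ^ 4 * b)))) := by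
  obtain ⟨ν, hprob, hν, hlaw⟩ := hE.exists_map_eq hM
  set S := sqrtCLM (covMat P₀ E)
  have hbessel : IsBessel b fun a : Fin n × Fin p =>
      u a.1 • (D ∘L S) (EuclideanSpace.basisFun (Fin p) ℝ a.2) :=
    (isBessel_smul_apply _ (D ∘L S) u).mono (by simpa [hu] using hD)
  have hsum : ∑ a : Fin n × Fin p,
      ‖u a.1 • (D ∘L S) (EuclideanSpace.basisFun (Fin p) ℝ a.2)‖ ^ 2 = τ := by
    rw [sum_norm_sq_smul_apply, hu, one_pow, one_mul, ← hτ]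
    rfl
  have hsqrt : Measurable (matSqrt (covMat P₀ E)).mulVec :=
    (Continuous.matrix_mulVec continuous_const continuous_id).measurable
  have hmeas : MeasurableSet {x : Fin n → Fin p → ℝ |
      ‖D (rowCombination (Matrix.of x) u)‖ ^ 2 ∉ Set.Icc (τ / 2) (3 * τ / 2)} := by
    refine (measurableSet_Icc.preimage (Continuous.measurable ?_)).compl
    simp only [rowCombination_apply]
    fun_prop
  have htail := measure_norm_sq_notMem_Icc_le (fun a : Fin n × Fin p => hν a.2)
    (by linarith : 1 ≤ M + 1) hbessel hb hsum
  rw [← Set.preimage_ofPred_eq (f := fun ω i => Es i ω)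
      (p := fun x => ‖D (rowCombination (Matrix.of x) u)‖ ^ 2 ∉ Set.Icc (τ / 2) (3 * τ / 2)),
    ← Measure.map_apply_of_aemeasurable
      (aemeasurable_pi_lambda _ fun i => (hcopy i).aemeasurable_fst) hmeas,
    map_sample_eq_pi_map hcopy hind hsqrt hlaw, Measure.map_apply (by fun_prop) hmeas]
  simpa only [Set.preimage_ofPred_eq, apply_rowCombination_matSqrt] using htail

theorem exp_neg_natCast_le_inv {n : ℕ} (hn : 0 < n) : Real.exp (-(n : ℝ)) ≤ 1 / n := by
  have hn' : (0 : ℝ) < n := Nat.cast_pos.2 hn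
  rw [Real.exp_neg, one_div]
  exact inv_anti₀ hn' (by linarith [Real.add_one_le_exp (n : ℝ)])

theorem mul_two_mul_exp_neg_le {n : ℕ} (hn : 0 < n) {N x : ℝ} (hN : N ≤ 17 ^ n)
    (hx : 4 * n ≤ x) : N * (2 * Real.exp (-x)) ≤ 2 / n := by
  have h17 : (17 : ℝ) ≤ Real.exp 3 := by
    have he := Real.exp_one_gt_d9
    calc (17 : ℝ) ≤ 2.7182818283 ^ 3 := by norm_num
      _ ≤ Real.exp 1 ^ 3 := by gcongr
      _ = Real.exp 3 := by rw [← Real.exp_nat_mul]; norm_num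
  calc N * (2 * Real.exp (-x)) ≤ Real.exp 3 ^ n * (2 * Real.exp (-(4 * n))) := by
        gcongr
        exact hN.trans (by gcongr)
    _ = 2 * Real.exp (-(n : ℝ)) := by
        rw [← Real.exp_nat_mul, mul_left_comm, ← Real.exp_add]
        ring_nf
    _ ≤ 2 * (1 / n) := by gcongr; exact exp_neg_natCast_le_inv hn
    _ = 2 / n := by ring

theorem measure_exists_norm_sq_apply_rowCombination_lt_le [IsProbabilityMeasure P₀] (hM : 0 < M)
    (hE : NoiseSubGaussian P₀ E M) (hcopy : ∀ i, IdentDistrib (Es i) E P P₀)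
    (hind : iIndepFun Es P) (D : EuclideanSpace ℝ (Fin p) →L[ℝ] H) (hb : 0 < b)
    (hD : ‖D ∘L sqrtCLM (covMat P₀ E)‖ ^ 2 ≤ b)
    (hτ : ∑ j, ‖D (sqrtCLM (covMat P₀ E) (EuclideanSpace.basisFun (Fin p) ℝ j))‖ ^ 2 = τ)
    (hn : 0 < n) (hnτ : 4 * n ≤ τ / (2048 * (M + 1) ^ 4 * b)) :
    P {ω | ∃ u, ‖u‖ = 1 ∧ ‖D (rowCombination (Matrix.of fun i => Es i ω) u)‖ ^ 2 < τ / 4}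
      ≤ ENNReal.ofReal (2 / n) := by
  have hτ0 : 0 < τ := by
    have hpos : 0 < τ / (2048 * (M + 1) ^ 4 * b) := lt_of_lt_of_le (by positivity) hnτ
    exact (div_pos_iff_of_pos_right (by positivity)).1 hpos
  obtain ⟨N, hN, hcov, hcard⟩ := exists_finset_isCover_card_le (ε := 1 / 8) (by norm_num)
    (isCompact_sphere (0 : EuclideanSpace ℝ (Fin n)) 1) zero_le_one Metric.sphere_subset_closedBall
  have hcard' : (N.card : ℝ) ≤ 17 ^ n := by norm_num at hcard; exact hcard
  let bad (v : EuclideanSpace ℝ (Fin n)) : Set Ω := {ω |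
    ‖D (rowCombination (Matrix.of fun i => Es i ω) v)‖ ^ 2 ∉ Set.Icc (τ / 2) (3 * τ / 2)}
  have hsub : {ω | ∃ u, ‖u‖ = 1 ∧
      ‖D (rowCombination (Matrix.of fun i => Es i ω) u)‖ ^ 2 < τ / 4} ⊆ ⋃ v ∈ N, bad v := by
    rintro ω ⟨u, hu, hlt⟩
    by_contra hω
    simp only [bad, Set.mem_iUnion₂, Set.mem_ofPred_eq, not_exists, not_not] at hω
    exact hlt.not_ge
      (le_norm_apply_sq_of_isCover_sphere (D ∘L rowCombination _) hcov hτ0 hω hu)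
  calc _ ≤ ∑ v ∈ N, P (bad v) := (measure_mono hsub).trans (measure_biUnion_finset_le N bad)
    _ ≤ ∑ v ∈ N, 2 * ENNReal.ofReal (Real.exp (-(τ / (2048 * (M + 1) ^ 4 * b)))) :=
        Finset.sum_le_sum fun v hv => measure_norm_sq_apply_rowCombination_notMem_Icc_le hM hE
          hcopy hind D hb hD hτ (mem_sphere_zero_iff_norm.1 (hN hv))
    _ = ENNReal.ofReal (N.card * (2 * Real.exp (-(τ / (2048 * (M + 1) ^ 4 * b))))) := by
        rw [Finset.sum_const, nsmul_eq_mul, ENNReal.ofReal_mul (by positivity),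
          ENNReal.ofReal_mul zero_le_two, ENNReal.ofReal_natCast, ENNReal.ofReal_ofNat]
    _ ≤ ENNReal.ofReal (2 / n) :=
        ENNReal.ofReal_le_ofReal (mul_two_mul_exp_neg_le hn hcard' hnτ)

theorem ofReal_one_sub_le_measure_of_compl_subset [IsProbabilityMeasure P] {G B : Set Ω} {r : ℝ}
    (hr : 0 ≤ r) (hGB : Bᶜ ⊆ G) (hB : P B ≤ ENNReal.ofReal r) : ENNReal.ofReal (1 - r) ≤ P G := by
  rw [ENNReal.ofReal_sub _ hr, ENNReal.ofReal_one, tsub_le_iff_right, ← measure_univ (μ := P)]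
  calc P Set.univ ≤ P (G ∪ B) := by
        rw [Set.union_comm, Set.compl_subset_iff_union.1 hGB]
    _ ≤ P G + P B := measure_union_le G B
    _ ≤ P G + ENNReal.ofReal r := by gcongr

end Concentration

section EffectiveRank

variable {Ω : Type*} [MeasurableSpace Ω] {μ : Measure Ω} {d : ℕ} {Q : Matrix (Fin d) (Fin d) ℝ}

theorem posSemidef_covMat [IsFiniteMeasure μ] {V : Ω → Fin d → ℝ}
    (hV : ∀ j, MemLp (fun ω => V ω j) 2 μ) : (covMat μ V).PosSemidef := by
  refine Matrix.PosSemidef.of_dotProduct_mulVec_nonneg ?_ fun x => ?_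
  · ext i j
    simp [covMat, covariance_comm]
  · have hmeas (j : Fin d) : AEMeasurable (fun ω => V ω j) μ := (hV j).aemeasurable
    have hvar := variance_nonneg (fun ω => ∑ i, x i * V ω i) μ
    rw [← covariance_self (by fun_prop),
      covariance_fun_sum_fun_sum (fun i => (hV i).const_mul (x i))
        fun i => (hV i).const_mul (x i)] at hvar
    refine hvar.trans_eq ?_
    simp only [star_trivial, dotProduct, Matrix.mulVec, covMat, Matrix.of_apply, Finset.mul_sum,
      covariance_const_mul_left, covariance_const_mul_right]
    exact Finset.sum_congr rfl fun i _ => Finset.sum_congr rfl fun j _ => by ring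

theorem opNorm_pos_of_lt_effRank {c : ℝ} (hc : 1 ≤ c) (h : c < effRank Q) : 0 < opNorm Q := by
  rw [effRank] at h
  split_ifs at h with hQ
  · exact absurd hc h.not_ge
  · exact norm_pos_iff.2 (map_ne_zero_iff _ (EquivLike.injective _) |>.2 hQ)

theorem mul_opNorm_lt_trace_of_lt_effRank {c : ℝ} (hc : 1 ≤ c) (h : c < effRank Q) :
    c * opNorm Q < Q.trace := by
  have hpos := opNorm_pos_of_lt_effRank hc h
  rw [effRank] at h
  split_ifs at h
  · exact absurd hc h.not_ge
  · exact (lt_div_iff₀ hpos).1 h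

theorem trace_le_two_mul_sum_norm_sq_starProjection_orthogonal (hQ : Q.PosSemidef)
    {U : Submodule ℝ (EuclideanSpace ℝ (Fin d))}
    (hU : 2 * Module.finrank ℝ U * opNorm Q ≤ Q.trace) :
    Q.trace ≤ 2 * ∑ j, ‖Uᗮ.starProjection
      (sqrtCLM Q (EuclideanSpace.basisFun (Fin d) ℝ j))‖ ^ 2 := by
  have h := sum_norm_sq_sub_le_sum_norm_sq_starProjection_orthogonal
    (EuclideanSpace.basisFun (Fin d) ℝ) (sqrtCLM Q) U
  rw [sum_norm_sq_sqrtCLM hQ, norm_sqrtCLM_sq hQ] at h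
  linarith

theorem norm_starProjection_comp_sqrtCLM_sq_le (hQ : Q.PosSemidef)
    (U : Submodule ℝ (EuclideanSpace ℝ (Fin d))) :
    ‖U.starProjection ∘L sqrtCLM Q‖ ^ 2 ≤ opNorm Q := by
  rw [← norm_sqrtCLM_sq hQ]
  gcongr
  exact (ContinuousLinearMap.opNorm_comp_le _ _).trans
    (mul_le_of_le_one_left (norm_nonneg _) U.starProjection_norm_le)

theorem NoiseSubGaussian.memLp [IsFiniteMeasure μ] {E : Ω → Fin d → ℝ} {M : ℝ}
    (hE : NoiseSubGaussian μ E M) (j : Fin d) : MemLp (fun ω => E ω j) 2 μ := by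
  obtain ⟨Et, hEt, hmeas, -, -, hvar, -⟩ := hE
  have hEt2 (k : Fin d) : MemLp (fun ω => Et ω k) 2 μ := by
    rw [← evariance_lt_top_iff_memLp (hmeas k).aestronglyMeasurable]
    exact lt_top_iff_ne_top.2 fun htop => by simpa [variance, htop] using hvar k
  refine (memLp_finsetSum Finset.univ fun k _ =>
    (hEt2 k).const_mul (matSqrt (covMat μ E) j k)).ae_eq ?_
  filter_upwards [hEt] with ω hω
  rw [hω]
  rfl

end EffectiveRank

section DataMatrix

variable {n p K : ℕ} {Ω : Type*} {A : Matrix (Fin p) (Fin K) ℝ} {Zs : Fin n → Ω → Fin K → ℝ}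
  {Es : Fin n → Ω → Fin p → ℝ} {ω : Ω} {t : ℝ}

theorem le_sq_sigma_dataMatrix_and_interpolates (hn : 0 < n) (ht : 0 < t)
    (h : ∀ u, ‖u‖ = 1 → t ≤ ‖(LinearMap.range (Matrix.toEuclideanLin A))ᗮ.starProjection
      (rowCombination (Matrix.of fun i => Es i ω) u)‖ ^ 2) :
    t ≤ sigma n (dataMatrix A Zs Es ω) ^ 2 ∧
      ∀ y, (dataMatrix A Zs Es ω).mulVec (minNormEstimator (dataMatrix A Zs Es ω) y) = y := by
  refine le_sq_sigma_and_interpolates hn ht fun u hu => (h u hu).trans ?_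
  rw [← starProjection_orthogonal_rowCombination_dataMatrix A Zs]
  gcongr
  exact Submodule.norm_starProjection_apply_le _ _

end DataMatrix

end FactorRegression

open FactorRegression in
theorem mainTheorem4_general (M : ℝ) (hM : 0 < M) :
    ∃ C c c' : ℝ, 0 < C ∧ 0 < c ∧ 0 < c' ∧
      ∀ (n p K : ℕ), 0 < n → K ≤ n →
      ∀ (Ω₀ : Type*) [MeasurableSpace Ω₀] (P₀ : Measure Ω₀) [IsProbabilityMeasure P₀]
        (Ω : Type*) [MeasurableSpace Ω] (P : Measure Ω) [IsProbabilityMeasure P]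
        (E : Ω₀ → Fin p → ℝ) (Zs : Fin n → Ω → Fin K → ℝ) (Es : Fin n → Ω → Fin p → ℝ)
        (A : Matrix (Fin p) (Fin K) ℝ),
        (∀ i, IdentDistrib (Es i) E P P₀) → iIndepFun Es P →
        NoiseSubGaussian P₀ E M →
        C * (n : ℝ) < effRank (covMat P₀ E) →
        0 < (covMat P₀ E).trace ∧
        ENNReal.ofReal (1 - c / (n : ℝ)) ≤
          P {ω | c' * (covMat P₀ E).trace ≤ sigma n (dataMatrix A Zs Es ω) ^ 2 ∧
              ∀ y, (dataMatrix A Zs Es ω).mulVec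
                (minNormEstimator (dataMatrix A Zs Es ω) y) = y} := by
  -- `16384 = 2 * 4 * 2048`: `tr Σ_E ≤ 2 τ`, and `τ / (2048 (M + 1)⁴ ‖Σ_E‖)` has to reach `4 n`.
  refine ⟨16384 * (M + 1) ^ 4, 2, 1 / 8, by positivity, by norm_num, by norm_num, ?_⟩
  intro n p K hn hKn Ω₀ _ P₀ _ Ω _ P _ E Zs Es A hcopy hind hE hrank
  set Q := covMat P₀ E
  set U := LinearMap.range (Matrix.toEuclideanLin A)
  set τ := ∑ j, ‖Uᗮ.starProjection
    (sqrtCLM Q (EuclideanSpace.basisFun (Fin p) ℝ j))‖ ^ 2 with hτ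
  have hQ : Q.PosSemidef := posSemidef_covMat hE.memLp
  have hC : 16384 * (n : ℝ) ≤ 16384 * (M + 1) ^ 4 * n := by
    gcongr
    exact le_mul_of_one_le_right (by norm_num) (one_le_pow₀ (by linarith))
  have hn1 : (1 : ℝ) ≤ n := Nat.one_le_cast.2 hn
  have hop := opNorm_pos_of_lt_effRank (by linarith) hrank
  have htr := mul_opNorm_lt_trace_of_lt_effRank (by linarith) hrank
  have hU : 2 * Module.finrank ℝ U * opNorm Q ≤ Q.trace := by
    have hUn : (Module.finrank ℝ U : ℝ) ≤ n := by
      exact_mod_cast (LinearMap.finrank_range_le (Matrix.toEuclideanLin A)).trans (by simpa)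
    exact (mul_le_mul_of_nonneg_right (by linarith) hop.le).trans htr.le
  have hQτ := trace_le_two_mul_sum_norm_sq_starProjection_orthogonal hQ hU
  have htr0 : 0 < Q.trace := lt_trans (by positivity) htr
  have hnτ : 4 * n ≤ τ / (2048 * (M + 1) ^ 4 * opNorm Q) := by
    rw [le_div_iff₀ (by positivity)]
    linarith
  refine ⟨htr0, ofReal_one_sub_le_measure_of_compl_subset (by positivity) (fun ω hω => ?_)
    (measure_exists_norm_sq_apply_rowCombination_lt_le hM hE hcopy hind Uᗮ.starProjection hop
      (norm_starProjection_comp_sqrtCLM_sq_le hQ Uᗮ) hτ.symm hn hnτ)⟩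
  have hX := le_sq_sigma_dataMatrix_and_interpolates (Zs := Zs) hn (by linarith : 0 < τ / 4)
    fun u hu => not_lt.1 fun h => hω ⟨u, hu, h⟩
  exact ⟨by linarith [hX.1], hX.2⟩

theorem mainTheorem4 (M : ℝ) (hM : 0 < M) :
    ∃ C c c' : ℝ, 0 < C ∧ 0 < c ∧ 0 < c' ∧
      ∀ (n p K : ℕ), K < n → n < p →
      ∀ (Ω₀ : Type*) [MeasurableSpace Ω₀] (P₀ : Measure Ω₀) [IsProbabilityMeasure P₀]
        (Ω : Type*) [MeasurableSpace Ω] (P : Measure Ω) [IsProbabilityMeasure P]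
        (Z : Ω₀ → Fin K → ℝ) (E : Ω₀ → Fin p → ℝ) (ε : Ω₀ → ℝ)
        (Zs : Fin n → Ω → Fin K → ℝ) (Es : Fin n → Ω → Fin p → ℝ) (εs : Fin n → Ω → ℝ)
        (A : Matrix (Fin p) (Fin K) ℝ) (β : Fin K → ℝ),
        FactorRegression.IsFactorModel P₀ P Z E ε Zs Es εs →
        A.rank = K →
        (FactorRegression.covMat P₀ Z).rank = K →
        FactorRegression.NoiseSubGaussian P₀ E M →
        FactorRegression.FactorSubGaussian P₀ Z M →
        FactorRegression.ResponseNoiseSubGaussian P₀ ε M →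
        C * (n : ℝ) < FactorRegression.effRank (FactorRegression.covMat P₀ E) →
        0 < (FactorRegression.covMat P₀ E).trace ∧
        ENNReal.ofReal (1 - c / (n : ℝ)) ≤
          P {ω | c' * (FactorRegression.covMat P₀ E).trace ≤
                FactorRegression.sigma n (FactorRegression.dataMatrix A Zs Es ω) ^ 2 ∧
              (FactorRegression.dataMatrix A Zs Es ω).mulVec
                  (FactorRegression.minNormEstimator (FactorRegression.dataMatrix A Zs Es ω)
                    (FactorRegression.response β Zs εs ω)) =
                FactorRegression.response β Zs εs ω} := by
  obtain ⟨C, c, c', hC, hc, hc', h⟩ := mainTheorem4_general M hM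
  refine ⟨C, c, c', hC, hc, hc', ?_⟩
  intro n p K hKn _ Ω₀ _ P₀ _ Ω _ P _ Z E ε Zs Es εs A β hmod _ _ hE _ _ hrank
  have hnoise : Measurable fun q : (Fin K → ℝ) × (Fin p → ℝ) × ℝ => q.2.1 := by fun_prop
  obtain ⟨htr, hle⟩ := h n p K (by omega) hKn.le Ω₀ P₀ Ω P E Zs Es A
    (fun i => (hmod.copies i).comp hnoise) (hmod.indep_sample.comp _ fun _ => hnoise) hE hrank
  exact ⟨htr, hle.trans (measure_mono fun ω hω => ⟨hω.1, hω.2 _⟩)⟩
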